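/- **Setting.** Let $\mathcal G=(\mathcal V,\mathcal E)$ be a finite digraph; $(i,j)\in\mathcal E$ means that node $i$ receives the pulses of node $j$. Let $\mathcal N_i^+$ be the set of in-neighbors of $i$ and $d_i=|\mathcal N_i^+|$. Nodes split into misbehaving nodes $\mathcal F$ and normal nodes $\mathcal R=\mathcal V\setminus\mathcal F$, $R=|\mathcal R|$. Each normal node $i$ is an oscillator with a phase $\phi_i(t)$ on the circle of length $1$, growing at rate $\omega_i(t)$ between events. Fix $f\in\mathbb N$, $0<\zeta<\tfrac12$ and $0<\alpha\le 1$. Initially all normal phases lie in $[0,\tfrac12)$ and all normal frequencies lie in $\Omega=[1,1+\delta(0)]$, where $\delta(0)$ is the maximal difference of two initial normal frequencies. $\Delta(t)$ is the length of the shortest arc containing the phases of all normal nodes. **Algorithm (run by every normal node $i$).** A flag $\gamma_i$ and a counter $c_i$ start at $0$; $\bar z_i,\underline z_i$ start at $0$. (1) When $\phi_i=1-\zeta$, $i$ emits a start pulse; when $\phi_i=1$, it emits an end pulse (fires), resets $\phi_i$ to $0$ and sets $\gamma_i=1$. (2) On receiving an end pulse, $i$ increases $c_i$ by $1$. If $c_i$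 becomes $f+1$, it sets $\bar z_i=1-\phi_i$ if $\phi_i\in[0.5,1)$ and $\bar z_i=0$ otherwise; if $c_i$ becomes $d_i-f$, it sets $\underline z_i=-\phi_i$ if $\phi_i\in[0,0.5)$ and $\underline z_i=0$ otherwise. (3) When $\phi_i=0.5$ and $\gamma_i=1$: if $c_i>d_i$, node $i$ reports an attack and changes neither phase nor frequency. If $c_i\le d_i$, it adds $(\bar z_i+\underline z_i)/2$ to its phase; to each end pulse received in the current round it attaches a relative frequency, namely $\eta_{ij}=\zeta/\big(\phi_i(\hat t_j)-\phi_i(\tilde t_j)\big)$ (clockwise difference on the circle) if exactly one start pulse (at $\tilde t_j$) and one end pulse (at $\hat t_j$) came from the sender $j$ in this round, and an arbitrary real number otherwise; it removes the $f_i=\max\{0,f-(d_i-c_i)\}$ largest and $f_i$ smallest of these values and multiplies $\omega_i$ by $a_{ii}+\sum_{j\in\mathcal J_i}a_{ij}\eta_{ij}$, where $\mathcal J_i$ indexes the remaining values and the weights, which may differ from update to update, are at least $\alpha$ and sum to $1$. In both cases it then sets $\gamma_i=0$, $c_i=0$ and starts a new round. Misbehaving nodes emit start and end pulses at arbitrary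 instants; only finitely many events occur in bounded time, and simultaneous events are processed one after another in any order. The events counted below are the firings (end pulses) of all nodes and the updates (3) of normal nodes. Let $\bar k$ be a number such that, as long as the attack is stealthy (no normal node has counted more than $d_i$ end pulses in a round), each normal node makes at least one update within any $\bar k$ consecutive events. **Theorem.** Suppose that $|\mathcal F\cap\mathcal N_i^+|\le f$ for every $i\in\mathcal R$, that $\mathcal G$ is $(2f+1)$-robust (for any disjoint nonempty proper subsets $\mathcal V_1,\mathcal V_2$ of $\mathcal V$, some node of $\mathcal V_1$ has at least $2f+1$ in-neighbors outside $\mathcal V_1$, or some node of $\mathcal V_2$ has at least $2f+1$ in-neighbors outside $\mathcal V_2$), and that $$\Delta(0)+\frac{2\bar kR}{\alpha^{\bar kR}}\,\delta(0)<0.5-\zeta .$$ Then at least one of the following holds. (a) Resilient synchronization: for all $t\ge0$, $\omega_i(t)\in\Omega$ for every $i\in\mathcal R$, and $\Delta(t)<0.5$; and for all $i,j\in\mathcal R$, the distance between $\phi_i(t)$ and $\phi_j(t)$ on the circle and $|\omega_i(t)-\omega_j(t)|$ tend to $0$ as $t\to\infty$. (b) The misbehavior is detected: some normal node that has a misbehaving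 in-neighbor reports an attack at some time. -/

import Mathlib

open Filter Topology

noncomputable section

namespace PulseSync

/-! ### Graphs.  `G.Adj i j` means that `i` receives the pulses of `j`. -/

section Graph

variable {V : Type*} [Fintype V]

open Classical in
/-- The in-neighbours of `i`. -/
def inNbrs (G : Digraph V) (i : V) : Finset V := {j | G.Adj i j}

/-- The in-degree `d_i`. -/
def inDeg (G : Digraph V) (i : V) : ℕ := (inNbrs G i).card

open Classical in
/-- `r`-robustness of a digraph. -/
def IsRobust (G : Digraph V) (r : ℕ) : Prop :=
  ∀ A B : Finset V, A.Nonempty → B.Nonempty → A ≠ Finset.univ → B ≠ Finset.univ → Disjoint A B →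
    (∃ i ∈ A, r ≤ (inNbrs G i \ A).card) ∨ (∃ i ∈ B, r ≤ (inNbrs G i \ B).card)

open Classical in
/-- The `f`-local attack model: every normal node (every node outside the set `F` of misbehaving
nodes) has at most `f` misbehaving in-neighbours. -/
def IsLocalAttack (G : Digraph V) (F : Finset V) (f : ℕ) : Prop :=
  ∀ i, i ∉ F → (F ∩ inNbrs G i).card ≤ f

open Classical in
/-- The number `R` of normal nodes. -/
def numNormal (F : Finset V) : ℕ := (Finset.univ \ F).card

end Graph

/-! ### Phases on the circle of length one -/

/-- The clockwise distance from the phase `y` to the phase `x`, for phases in `[0, 1]`. -/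
def cwDist (x y : ℝ) : ℝ := if y ≤ x then x - y else 1 - y + x

/-- The length of the shortest arc of the circle of length one that contains the phases of all
normal oscillators; the arc that starts at `a` and runs clockwise over the length `l` consists of
the phases `x` with `Int.fract (x - a) ≤ l`. -/
def arcLength {V : Type*} (F : Finset V) (φ : V → ℝ) : ℝ :=
  sInf {l : ℝ | 0 ≤ l ∧ ∃ a : ℝ, ∀ i, i ∉ F → Int.fract (φ i - a) ≤ l}

/-! ### The algorithm -/

/-- The events: emission of a start pulse, emission of an end pulse (firing), and the execution of
the update step. -/
inductive PEvent (V : Type*) where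
  | start (j : V)
  | fire (j : V)
  | update (j : V)

/-- The local state of an oscillator. -/
@[ext]
structure Osc where
  /-- the phase `φ_i` -/
  phase : ℝ
  /-- the absolute frequency `ω_i` -/
  freq : ℝ
  /-- the flag `γ_i` -/
  flag : Bool
  /-- whether the start pulse was already emitted since the last firing -/
  started : Bool
  /-- the (indices of the) start pulses received in the current round -/
  starts : Finset ℕ
  /-- the (indices of the) end pulses received in the current round -/
  ends : Finset ℕ
  /-- the variable `z̄_i` -/
  zUp : ℝ
  /-- the variable `z̲_i` -/
  zDown : ℝ

namespace Osc

/-- The counter `c_i`: the number of end pulses received in the current round. -/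
def count (o : Osc) : ℕ := o.ends.card

/-- Free evolution over the duration `τ`. -/
def flow (o : Osc) (τ : ℝ) : Osc := { o with phase := o.phase + o.freq * τ }

/-- Some action of the oscillator is due. -/
def Ready (ζ : ℝ) (o : Osc) : Prop :=
  o.phase = 1 ∨ (o.phase = 1 - ζ ∧ o.started = false) ∨ (o.phase = 1 / 2 ∧ o.flag = true)

/-- Reception of the start pulse with index `k`. -/
def hearStart (k : ℕ) (o : Osc) : Osc := { o with starts := insert k o.starts }

open Classical in
/-- Reception of the end pulse with index `k` by an oscillator of in-degree `d`. -/
def hearEnd (f d k : ℕ) (o : Osc) : Osc :=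
  { o with
    ends := insert k o.ends
    zUp :=
      if o.count + 1 = f + 1 then
        (if 1 / 2 ≤ o.phase ∧ o.phase < 1 then 1 - o.phase else 0)
      else o.zUp
    zDown :=
      if o.count + 1 = d - f then
        (if 0 ≤ o.phase ∧ o.phase < 1 / 2 then -o.phase else 0)
      else o.zDown }

/-- Emission of the own start pulse. -/
def emitStart (o : Osc) : Osc := { o with started := true }

/-- Emission of the own end pulse, with reset of the phase. -/
def emitEnd (o : Osc) : Osc := { o with phase := 0, flag := true, started := false }

/-- The reset at the end of a round. -/
def reset (o : Osc) : Osc := { o with flag := false, starts := ∅, ends := ∅ }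

end Osc

/-- `J` is what remains of the finite family `v l`, `l ∈ P`, after removal of the `m` largest and
the `m` smallest values (ties are broken arbitrarily; nothing remains if there are fewer than `2m`
values). -/
def IsTrimming (v : ℕ → ℝ) (P : Finset ℕ) (m : ℕ) (J : Finset ℕ) : Prop :=
  (P.card < 2 * m ∧ J = ∅) ∨
  ∃ L U : Finset ℕ, L.card = m ∧ U.card = m ∧ Disjoint L J ∧ Disjoint U J ∧ Disjoint L U ∧
    L ∪ J ∪ U = P ∧ (∀ l ∈ L, ∀ x ∈ J ∪ U, v l ≤ v x) ∧ (∀ u ∈ U, ∀ x ∈ L ∪ J, v x ≤ v u)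

open Classical in
/-- `v` assigns to each end pulse received in the current round the relative frequency with respect
to its sender.  Here `ev` lists all events, `ph l` is the phase of the receiver at event `l`,
and `S`, `E` are the indices of the start and end pulses received in the current round.
If exactly one start pulse and one end pulse came from `j`, the value is
`ζ / (φ_i(end pulse) - φ_i(start pulse))`, the difference being taken clockwise on the circle.
If `j` did not send exactly these two pulses (so that `j` is not following the protocol), the values
attached to its end pulses are left unrestricted. -/
def IsRelFreq {V : Type*} (ζ : ℝ) (ev : ℕ → PEvent V) (ph : ℕ → ℝ) (S E : Finset ℕ)
    (v : ℕ → ℝ) : Prop :=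
  ∀ (j : V) (a b : ℕ), S.filter (fun l => ev l = PEvent.start j) = {a} →
    E.filter (fun l => ev l = PEvent.fire j) = {b} → v b = ζ / cwDist (ph b) (ph a)

/-- The update step of an oscillator of in-degree `d`, from the local state `o` to `o'`. -/
def UpdateStep {V : Type*} (f d : ℕ) (ζ α : ℝ) (ev : ℕ → PEvent V) (ph : ℕ → ℝ)
    (o o' : Osc) : Prop :=
  (d < o.count ∧ o' = o.reset) ∨
  (o.count ≤ d ∧ ∃ (v w : ℕ → ℝ) (a : ℝ) (J : Finset ℕ),
    IsRelFreq ζ ev ph o.starts o.ends v ∧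
    IsTrimming v o.ends (f - (d - o.count)) J ∧
    α ≤ a ∧ (∀ l ∈ J, α ≤ w l) ∧ a + ∑ l ∈ J, w l = 1 ∧
    o' = { o.reset with
      phase := o.phase + (o.zUp + o.zDown) / 2
      freq := (a + ∑ l ∈ J, w l * v l) * o.freq })

open Classical in
/-- The effect of the `k`-th event on the normal node `i`, from the local state `o` just before to
the local state `o'` just after. -/
def LocalStep {V : Type*} [Fintype V] (G : Digraph V) (f : ℕ) (ζ α : ℝ) (ev : ℕ → PEvent V)
    (ph : ℕ → ℝ) (k : ℕ) (i : V) (o o' : Osc) : Prop :=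
  match ev k with
  | PEvent.start j =>
      o' = (let o₁ := if G.Adj i j then o.hearStart k else o
            if j = i then o₁.emitStart else o₁)
  | PEvent.fire j =>
      o' = (let o₁ := if G.Adj i j then o.hearEnd f (inDeg G i) k else o
            if j = i then o₁.emitEnd else o₁)
  | PEvent.update j =>
      if j = i then UpdateStep f (inDeg G i) ζ α ev ph o o' else o' = o

/-- An execution of the algorithm by the nodes outside `F`, the nodes in `F` emitting start and end
pulses at arbitrary instants.  `time 0 = 0`, `event k` happens at time `time (k + 1)`, and `state k`
is the state right after the first `k` events (the entries of the nodes in `F` carry no meaning).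
Simultaneous events are listed one after the other, in any order. -/
structure Execution {V : Type*} [Fintype V] (G : Digraph V) (F : Finset V) (f : ℕ) (ζ α : ℝ) where
  time : ℕ → ℝ
  event : ℕ → PEvent V
  state : ℕ → V → Osc
  time_zero : time 0 = 0
  time_le : ∀ k, time k ≤ time (k + 1)
  time_tendsto : Tendsto time atTop atTop
  /-- initial values of the auxiliary variables -/
  init : ∀ i, i ∉ F → (state 0 i).flag = false ∧ (state 0 i).started = false ∧
    (state 0 i).starts = ∅ ∧ (state 0 i).ends = ∅ ∧ (state 0 i).zUp = 0 ∧ (state 0 i).zDown = 0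
  /-- no normal node lets time pass while one of its actions is due -/
  urgent : ∀ k, ∀ i, i ∉ F → ∀ u, 0 ≤ u → u < time (k + 1) - time k →
    ¬ ((state k i).flow u).Ready ζ
  /-- normal nodes emit start pulses only at phase `1 - ζ` -/
  start_ok : ∀ k i, i ∉ F → event k = PEvent.start i →
    ((state k i).flow (time (k + 1) - time k)).phase = 1 - ζ ∧ (state k i).started = false
  /-- normal nodes fire only at phase `1` -/
  fire_ok : ∀ k i, i ∉ F → event k = PEvent.fire i →
    ((state k i).flow (time (k + 1) - time k)).phase = 1
  /-- only normal nodes perform update steps, and only at phase `1 / 2` with the flag set -/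
  update_ok : ∀ k i, event k = PEvent.update i → i ∉ F ∧
    ((state k i).flow (time (k + 1) - time k)).phase = 1 / 2 ∧ (state k i).flag = true
  /-- evolution of the local states of the normal nodes -/
  step : ∀ k i, i ∉ F →
    LocalStep G f ζ α event (fun l => ((state l i).flow (time (l + 1) - time l)).phase) k i
      ((state k i).flow (time (k + 1) - time k)) (state (k + 1) i)

namespace Execution

variable {V : Type*} [Fintype V] {G : Digraph V} {F : Finset V} {f : ℕ} {ζ α : ℝ}

/-- The number of events up to and including time `t`. -/
def index (X : Execution G F f ζ α) (t : ℝ) : ℕ := sSup {k | X.time k ≤ t}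

/-- The phase `φ_i(t)` (right-continuous in `t`). -/
def phase (X : Execution G F f ζ α) (i : V) (t : ℝ) : ℝ :=
  ((X.state (X.index t) i).flow (t - X.time (X.index t))).phase

/-- The absolute frequency `ω_i(t)` (right-continuous in `t`). -/
def freq (X : Execution G F f ζ α) (i : V) (t : ℝ) : ℝ := (X.state (X.index t) i).freq

/-- The length `Δ(t)` of the normal containing arc. -/
def arc (X : Execution G F f ζ α) (t : ℝ) : ℝ := arcLength F (fun i => X.phase i t)

/-- `Δ(0)`, the arc length of the initial phases. -/
def initArc (X : Execution G F f ζ α) : ℝ := arcLength F (fun i => (X.state 0 i).phase)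

/-- `δ(0)`, the maximal difference between initial frequencies of normal oscillators. -/
def initSpread (X : Execution G F f ζ α) : ℝ :=
  ⨆ p : {i // i ∉ F} × {i // i ∉ F}, |(X.state 0 p.1).freq - (X.state 0 p.2).freq|

/-- Up to event `n` the attack is stealthy: no normal node has counted more end pulses in a round
than it has in-neighbours. -/
def StealthyUntil (X : Execution G F f ζ α) (n : ℕ) : Prop :=
  ∀ k ≤ n, ∀ i, i ∉ F → (X.state k i).count ≤ inDeg G i

open Classical in
/-- As long as the attack is stealthy, each normal node makes at least one update within any `K`
consecutive events, the events being the firings of all nodes and the updates of normal nodes. -/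
def IsUpdateBound (X : Execution G F f ζ α) (K : ℕ) : Prop :=
  ∀ a b : ℕ, K ≤ ((Finset.Ico a b).filter (fun k => ∀ j, X.event k ≠ PEvent.start j)).card →
    X.StealthyUntil b → ∀ i, i ∉ F → ∃ k ∈ Finset.Ico a b, X.event k = PEvent.update i

/-- Resilient synchronization: safety, and synchronization of phases (on the circle of length one)
and of frequencies. -/
def ResilientSync (X : Execution G F f ζ α) : Prop :=
  (∀ t, 0 ≤ t → (∀ i, i ∉ F → X.freq i t ∈ Set.Icc 1 (1 + X.initSpread)) ∧ X.arc t < 1 / 2) ∧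
  ∀ i j, i ∉ F → j ∉ F →
    Tendsto (fun t => dist (X.phase i t : UnitAddCircle) (X.phase j t : UnitAddCircle))
      atTop (𝓝 0) ∧
    Tendsto (fun t => |X.freq i t - X.freq j t|) atTop (𝓝 0)

/-- The normal node `i` reports an attack at event `k`: at its update step it has counted more end
pulses in the current round than it has in-neighbours. -/
def Detects (X : Execution G F f ζ α) (k : ℕ) (i : V) : Prop :=
  i ∉ F ∧ X.event k = PEvent.update i ∧ inDeg G i < (X.state k i).count

end Execution

end PulseSync

end

/-! Cut the execution into rounds: in round r every normal node i keeps one frequency ω_r(i), emits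
a start pulse, fires at a time T_r(i) and updates half a turn later. As long as the rounds of
different nodes do not mix, i hears exactly one start and one end pulse of each normal in-neighbour
j. Then η_ij ω_i is exactly ω_j, and if i counts at most d_i end pulses, at most f_i of them are
forged. Trimming therefore makes ω_{r+1} a resilient average of ω_r. The phase jump acts as if i had
fired at the mean of two clipped order statistics of the received firing times (`aimTime`), so
T_{r+1} is a resilient average of T_r up to a common shift and an error of at most the spread of
ω_r.

Resilient averaging contracts (`hull_contract`). Let A be the nodes near the maximum and B those
near the minimum. Robustness and the f-local bound give a node of A or of B with f + 1 normal
in-neighbours outside its set. The averaging takes this node out of its set, and no node enters if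
the margin shrinks by the factor β in each step. After R - 1 steps A or B is empty, and the spread
has lost the factor 1 - β^(R-1)/2.

Hence the frequency spreads have an explicitly bounded sum (`sum_le_of_window_contract`). This sum
controls the growth of the spread of the firing times, which by the assumption on Δ(0) and δ(0)
stays below 1/2 - ζ with some room. That smallness is just what keeps the rounds apart
(`IsRoundStart.all_end`, `IsRoundStart.next`), so a strong induction over the rounds closes the
circle (`good_rounds`). Both spreads then tend to 0, and the phases at an arbitrary time are
compared through lifts to the line (`exists_round_pair`).

Detection enters as a dichotomy: either (b) holds, or every node with a misbehaving in-neighbour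
counts few enough pulses; the other nodes do so anyway while the rounds are separated. The update
bound serves only through K ≥ 1, which makes the assumed constant dominate the one needed
(`growth_le`). -/

namespace PulseSync

variable {V : Type*} [Fintype V] {G : Digraph V} {F : Finset V} {f : ℕ}

/-! ### Resilient averaging -/

open Classical in
/-- The passage of node `i` from the value `x i` to the value `c` pulls it below the maximum `M`:
if its own value, or the values of at least `f + 1` normal in-neighbours, are at most `M - ε`,
then its new value is at most `M - β ε`. -/
def AttractsAt (G : Digraph V) (F : Finset V) (f : ℕ) (β : ℝ) (x : V → ℝ) (i : V) (c : ℝ) : Prop :=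
  ∀ M ε : ℝ, 0 ≤ ε → (∀ j, j ∉ F → x j ≤ M) →
    (x i ≤ M - ε ∨ f + 1 ≤ ((inNbrs G i \ F).filter (fun j => x j ≤ M - ε)).card) →
    c ≤ M - β * ε

/-- Every normal node is pulled below the maximum in the passage from `x` to `y`. -/
def Attracts (G : Digraph V) (F : Finset V) (f : ℕ) (β : ℝ) (x y : V → ℝ) : Prop :=
  ∀ i, i ∉ F → AttractsAt G F f β x i (y i)

theorem AttractsAt.le {β c : ℝ} {x : V → ℝ} {i : V} (h : AttractsAt G F f β x i c) (hi : i ∉ F)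
    {M : ℝ} (hM : ∀ j, j ∉ F → x j ≤ M) : c ≤ M := by
  simpa using h M 0 le_rfl hM (Or.inl (by simpa using hM i hi))

theorem AttractsAt.ge {β c : ℝ} {x : V → ℝ} {i : V} (h : AttractsAt G F f β (-x) i (-c))
    (hi : i ∉ F) {m : ℝ} (hm : ∀ j, j ∉ F → m ≤ x j) : m ≤ c := by
  have := h.le hi (M := -m) (fun j hj => by simpa using hm j hj)
  simpa using this

theorem Attracts.le {β : ℝ} {x y : V → ℝ} (h : Attracts G F f β x y) {i : V} (hi : i ∉ F) {M : ℝ}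
    (hM : ∀ j, j ∉ F → x j ≤ M) : y i ≤ M :=
  (h i hi).le hi hM

theorem Attracts.ge {β : ℝ} {x y : V → ℝ} (h : Attracts G F f β (-x) (-y)) {i : V} (hi : i ∉ F)
    {m : ℝ} (hm : ∀ j, j ∉ F → m ≤ x j) : m ≤ y i :=
  (h i hi).ge hi hm

-- Of the `2f + 1` in-neighbours outside `A` at most `f` misbehave. Here the robustness degree meets
-- the local bound.
open Classical in
theorem card_normal_outside (hlocal : IsLocalAttack G F f) {A : Finset V} {i : V} (hi : i ∉ F)
    (h : 2 * f + 1 ≤ (inNbrs G i \ A).card) :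
    f + 1 ≤ ((inNbrs G i \ F).filter (fun j => j ∉ A)).card := by
  have hsub : inNbrs G i \ A ⊆ ((inNbrs G i \ F).filter (fun j => j ∉ A)) ∪ (F ∩ inNbrs G i) := by
    intro j hj
    simp only [Finset.mem_sdiff, Finset.mem_union, Finset.mem_filter, Finset.mem_inter] at hj ⊢
    tauto
  have h1 := Finset.card_le_card hsub
  have h2 := Finset.card_union_le ((inNbrs G i \ F).filter (fun j => j ∉ A)) (F ∩ inNbrs G i)
  have h3 := hlocal i hi
  omega

open Classical in
/-- If the values above `M - ε` are taken exactly on `A`, some node of `A` having many in-neighbours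
outside `A` drops out. -/
theorem Attracts.drop {β : ℝ} {x y : V → ℝ} (h : Attracts G F f β x y)
    (hlocal : IsLocalAttack G F f) {M ε : ℝ} (hε : 0 ≤ ε) (hM : ∀ j, j ∉ F → x j ≤ M)
    {A : Finset V} (hA : ∀ j, j ∈ A ↔ j ∉ F ∧ M - ε < x j) {i : V} (hi : i ∈ A)
    (hcard : 2 * f + 1 ≤ (inNbrs G i \ A).card) : y i ≤ M - β * ε := by
  have hiF := ((hA i).1 hi).1
  refine h i hiF M ε hε hM (Or.inr ((card_normal_outside hlocal hiF hcard).trans ?_))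
  refine Finset.card_le_card fun j hj => ?_
  simp only [Finset.mem_filter, Finset.mem_sdiff] at hj ⊢
  refine ⟨hj.1, ?_⟩
  by_contra hlt
  exact hj.2 ((hA j).2 ⟨hj.1.2, not_le.1 hlt⟩)

open Classical in
/-- Contraction of the hull over a window of `N` steps, each of which is a resilient averaging
followed by a common shift and an individual perturbation of at most `e`. -/
theorem hull_contract (hlocal : IsLocalAttack G F f) (hrobust : IsRobust G (2 * f + 1))
    {β : ℝ} (hβ : 0 < β) (hβ1 : β ≤ 1) {N : ℕ} (hN : numNormal F ≤ N + 1)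
    (x y : ℕ → V → ℝ) (s e : ℕ → ℝ)
    (h1 : ∀ n < N, Attracts G F f β (x n) (y n)) (h2 : ∀ n < N, Attracts G F f β (-x n) (-y n))
    (hlo : ∀ n < N, ∀ i, i ∉ F → y n i + s n ≤ x (n + 1) i)
    (hhi : ∀ n < N, ∀ i, i ∉ F → x (n + 1) i ≤ y n i + s n + e n)
    {m M : ℝ} (hm : ∀ i, i ∉ F → m ≤ x 0 i) (hM : ∀ i, i ∉ F → x 0 i ≤ M)
    {i j : V} (hi : i ∉ F) (hj : j ∉ F) :
    x N i - x N j ≤ (1 - β ^ N / 2) * (M - m) + ∑ n ∈ Finset.range N, e n := by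
  have hD : 0 ≤ M - m := by linarith [hm i hi, hM i hi]
  set σ : ℕ → ℝ := fun n => ∑ l ∈ Finset.range n, s l with hσ
  set ê : ℕ → ℝ := fun n => ∑ l ∈ Finset.range n, e l with hê
  -- The margin starts at half the hull, so that the top set `A` and the bottom set `B` are
  -- disjoint. It loses in each step the factor `β` that averaging costs.
  set ε : ℕ → ℝ := fun n => β ^ n * ((M - m) / 2) with hεdef
  have hε : ∀ n, 0 ≤ ε n := fun n => by positivity
  have hεs : ∀ n, ε (n + 1) = β * ε n := fun n => by simp only [hεdef]; ring
  have hεD : ∀ n, 2 * ε n ≤ M - m := fun n => by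
    have : β ^ n ≤ 1 := pow_le_one₀ hβ.le hβ1
    simp only [hεdef]; nlinarith
  have hσs : ∀ n, σ (n + 1) = σ n + s n := fun n => Finset.sum_range_succ _ _
  have hês : ∀ n, ê (n + 1) = ê n + e n := fun n => Finset.sum_range_succ _ _
  set A : ℕ → Finset V := fun n =>
    Finset.univ.filter (fun i => i ∉ F ∧ M + σ n + ê n - ε n < x n i) with hA
  set B : ℕ → Finset V := fun n =>
    Finset.univ.filter (fun i => i ∉ F ∧ x n i < m + σ n + ε n) with hB
  have hAm : ∀ n k, k ∈ A n ↔ k ∉ F ∧ M + σ n + ê n - ε n < x n k := fun n k => by simp [hA]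
  have hBm : ∀ n k, k ∈ B n ↔ k ∉ F ∧ x n k < m + σ n + ε n := fun n k => by simp [hB]
  -- Relative to the hull translated by `σ` and raised at the top by `ê`, no node ever enters `A` or
  -- `B`. While both stay nonempty, each step removes a node from one of them.
  have main : ∀ n ≤ N, (∀ k, k ∉ F → x n k ≤ M + σ n + ê n) ∧ (∀ k, k ∉ F → m + σ n ≤ x n k) ∧
      0 ≤ ê n ∧ (A n = ∅ ∨ B n = ∅ ∨ (A n).card + (B n).card + n ≤ numNormal F) := by
    intro n
    induction n with
    | zero =>
      intro _
      refine ⟨by simpa [hσ, hê] using hM, by simpa [hσ] using hm, by simp [hê], Or.inr (Or.inr ?_)⟩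
      have hdisj : Disjoint (A 0) (B 0) := by
        rw [Finset.disjoint_left]
        intro k ha hb
        have h1 := ((hAm 0 k).1 ha).2
        have h2 := ((hBm 0 k).1 hb).2
        have h3 := hεD 0
        simp only [hσ, hê, Finset.range_zero, Finset.sum_empty] at h1 h2
        linarith
      rw [add_zero, ← Finset.card_union_of_disjoint hdisj]
      refine Finset.card_le_card fun k hk => ?_
      rcases Finset.mem_union.1 hk with hk | hk
      · simpa using ((hAm 0 k).1 hk).1
      · simpa using ((hBm 0 k).1 hk).1
    | succ n ih =>
      intro hn
      obtain ⟨hU, hL, he, hAB⟩ := ih (by omega)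
      have a1 := h1 n hn
      have a2 := h2 n hn
      have hL' : ∀ k, k ∉ F → (-x n) k ≤ -(m + σ n) := fun k hk => neg_le_neg (hL k hk)
      have hU1 : ∀ k, k ∉ F → x (n + 1) k ≤ M + σ (n + 1) + ê (n + 1) := fun k hk => by
        have := a1.le hk hU
        have := hhi n hn k hk
        rw [hσs, hês]; linarith
      have hL1 : ∀ k, k ∉ F → m + σ (n + 1) ≤ x (n + 1) k := fun k hk => by
        have := a2.ge hk hL
        have := hlo n hn k hk
        rw [hσs]; linarith
      have he1 : 0 ≤ ê (n + 1) := by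
        have := hlo n hn i hi
        have := hhi n hn i hi
        rw [hês]; linarith
      refine ⟨hU1, hL1, he1, ?_⟩
      have dropA : ∀ k, k ∉ F → y n k ≤ M + σ n + ê n - β * ε n → k ∉ A (n + 1) := by
        intro k hk hy hmem
        have h3 := ((hAm _ k).1 hmem).2
        have h4 := hhi n hn k hk
        rw [hσs, hês, hεs] at h3
        linarith
      have dropB : ∀ k, k ∉ F → (-y n) k ≤ -(m + σ n) - β * ε n → k ∉ B (n + 1) := by
        intro k hk hy hmem
        have h3 := ((hBm _ k).1 hmem).2
        have h4 := hlo n hn k hk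
        rw [hσs, hεs] at h3
        simp only [Pi.neg_apply] at hy
        linarith
      have subA : A (n + 1) ⊆ A n := by
        intro k hk
        have hkF := ((hAm _ k).1 hk).1
        by_contra hkA
        rw [hAm, not_and, not_lt] at hkA
        exact dropA k hkF (a1 k hkF _ _ (hε n) hU (Or.inl (hkA hkF))) hk
      have subB : B (n + 1) ⊆ B n := by
        intro k hk
        have hkF := ((hBm _ k).1 hk).1
        by_contra hkB
        rw [hBm, not_and, not_lt] at hkB
        refine dropB k hkF (a2 k hkF _ _ (hε n) hL' (Or.inl ?_)) hk
        have := hkB hkF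
        simp only [Pi.neg_apply]; linarith
      by_cases eA : A (n + 1) = ∅
      · exact Or.inl eA
      by_cases eB : B (n + 1) = ∅
      · exact Or.inr (Or.inl eB)
      have nA : (A n).Nonempty := (Finset.nonempty_iff_ne_empty.2 eA).mono subA
      have nB : (B n).Nonempty := (Finset.nonempty_iff_ne_empty.2 eB).mono subB
      rcases hAB with h | h | hAB
      · exact absurd h nA.ne_empty
      · exact absurd h nB.ne_empty
      have hdisj : Disjoint (A n) (B n) := by
        rw [Finset.disjoint_left]
        intro k ha hb
        have h1 := ((hAm n k).1 ha).2
        have h2 := ((hBm n k).1 hb).2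
        have h3 := hεD n
        linarith
      have uA : A n ≠ Finset.univ := by
        intro h
        obtain ⟨k, hk⟩ := nB
        exact Finset.disjoint_left.1 hdisj (h ▸ Finset.mem_univ k) hk
      have uB : B n ≠ Finset.univ := by
        intro h
        obtain ⟨k, hk⟩ := nA
        exact Finset.disjoint_left.1 hdisj hk (h ▸ Finset.mem_univ k)
      right; right
      -- The node named by robustness leaves its set, which pays for the increment of `n` in the
      -- count.
      rcases hrobust (A n) (B n) nA nB uA uB hdisj with ⟨k, hk, hc⟩ | ⟨k, hk, hc⟩
      · have hkF := ((hAm _ k).1 hk).1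
        have hout := dropA k hkF (a1.drop hlocal (hε n) hU (hAm n) hk hc)
        have := Finset.card_lt_card (Finset.ssubset_iff_subset_ne.2
          ⟨subA, fun h => hout (h ▸ hk)⟩)
        have := Finset.card_le_card subB
        omega
      · have hkF := ((hBm _ k).1 hk).1
        have hout := dropB k hkF (a2.drop hlocal (hε n) hL' (fun k => by
          rw [hBm, Pi.neg_apply]
          refine and_congr_right fun _ => ?_
          constructor <;> intro h <;> linarith) hk hc)
        have := Finset.card_lt_card (Finset.ssubset_iff_subset_ne.2
          ⟨subB, fun h => hout (h ▸ hk)⟩)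
        have := Finset.card_le_card subA
        omega
  obtain ⟨hU, hL, -, hAB⟩ := main N le_rfl
  have key : (1 - β ^ N / 2) * (M - m) + ∑ n ∈ Finset.range N, e n = M - m - ε N + ê N := by
    simp only [hεdef, hê]; ring
  rw [key]
  -- If both sets were inhabited, `N + 2 ≤ numNormal F ≤ N + 1` would follow. So `i` is not in `A N`
  -- or `j` is not in `B N`, which saves `ε N`.
  by_cases eA : i ∈ A N
  · by_cases eB : j ∈ B N
    · exfalso
      have cA := Finset.card_pos.2 ⟨i, eA⟩
      have cB := Finset.card_pos.2 ⟨j, eB⟩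
      rcases hAB with h | h | h
      · simp [h] at eA
      · simp [h] at eB
      · omega
    · rw [hBm, not_and, not_lt] at eB
      linarith [eB hj, hU i hi]
  · rw [hAm, not_and, not_lt] at eA
    linarith [eA hi, hL j hj]

/-! ### Scalar sequences contracting over a window -/

/-- Splitting off the first `N` terms bounds the sum `S` by `N * δ 0 + (1 - c / 2) * S`; solve for
`S`. -/
theorem sum_le_of_window_contract {δ : ℕ → ℝ} {N : ℕ} {c : ℝ} (hc : 0 < c)
    (h0 : ∀ n, 0 ≤ δ n) (hle : ∀ n, δ n ≤ δ 0)
    (h : ∀ n, δ (n + N) ≤ (1 - c / 2) * δ n) (r : ℕ) :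
    ∑ n ∈ Finset.range r, δ n ≤ 2 * N / c * δ 0 := by
  have e1 : ∑ n ∈ Finset.range r, δ n ≤ ∑ n ∈ Finset.range (N + r), δ n :=
    Finset.sum_le_sum_of_subset_of_nonneg (Finset.range_mono (by omega)) fun n _ _ => h0 n
  rw [Finset.sum_range_add] at e1
  have e2 : ∑ n ∈ Finset.range N, δ n ≤ N * δ 0 := by
    simpa using Finset.sum_le_sum fun n (_ : n ∈ Finset.range N) => hle n
  have e3 : ∑ n ∈ Finset.range r, δ (N + n) ≤ (1 - c / 2) * ∑ n ∈ Finset.range r, δ n := by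
    rw [Finset.mul_sum]
    exact Finset.sum_le_sum fun n _ => by simpa [add_comm] using h n
  rw [div_mul_eq_mul_div, le_div_iff₀ hc]
  linarith

/-- After `k` windows the initial bound has shrunk to `q ^ k * B`, while late errors below `ε`
accumulate to at most `ε / (1 - q)`, the fixed point of `s ↦ q * s + ε`. -/
theorem tendsto_zero_of_window_contract {D E : ℕ → ℝ} {N : ℕ} {q B : ℝ} (hq0 : 0 ≤ q) (hq : q < 1)
    (h0 : ∀ n, 0 ≤ D n) (hB : ∀ n, D n ≤ B) (hE : Tendsto E atTop (𝓝 0))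
    (h : ∀ n, D (n + N) ≤ q * D n + E n) : Tendsto D atTop (𝓝 0) := by
  have step : ∀ ε > 0, ∀ k : ℕ, ∀ᶠ n in atTop, D n ≤ q ^ k * B + ε / (1 - q) := by
    intro ε hε k
    have hq' : 0 < 1 - q := by linarith
    induction k with
    | zero =>
      refine Eventually.of_forall fun n => ?_
      have : 0 ≤ ε / (1 - q) := by positivity
      linarith [hB n]
    | succ k ih =>
      obtain ⟨n0, hn0⟩ := eventually_atTop.1 (ih.and (hE.eventually_lt_const hε))
      refine eventually_atTop.2 ⟨n0 + N, fun n hn => ?_⟩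
      obtain ⟨l, rfl⟩ := Nat.exists_eq_add_of_le' (show N ≤ n by omega)
      obtain ⟨h1, h2⟩ := hn0 l (by omega)
      have h3 := h l
      have h4 := mul_le_mul_of_nonneg_left h1 hq0
      have h5 : q * (q ^ k * B + ε / (1 - q)) + ε = q ^ (k + 1) * B + ε / (1 - q) := by
        field_simp; ring
      linarith
  refine tendsto_order.2 ⟨fun a ha => Eventually.of_forall fun n => ha.trans_le (h0 n),
    fun a ha => ?_⟩
  have hq' : 0 < 1 - q := by linarith
  have hlim : Tendsto (fun k : ℕ => q ^ k * B + a / 2) atTop (𝓝 (0 * B + a / 2)) :=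
    ((tendsto_pow_atTop_nhds_zero_of_lt_one hq0 hq).mul_const B).add_const _
  obtain ⟨k, hk⟩ := (hlim.eventually_lt_const (show 0 * B + a / 2 < a by linarith)).exists
  filter_upwards [step (a / 2 * (1 - q)) (by positivity) k] with n hn
  rw [mul_div_cancel_right₀ _ hq'.ne'] at hn
  linarith

/-- In a `(2f+1)`-robust graph an in-degree above `f` is at least `2f+1`. -/
theorem IsRobust.inDeg_dichotomy (hrobust : IsRobust G (2 * f + 1)) (i : V) :
    inDeg G i ≤ f ∨ 2 * f + 1 ≤ inDeg G i := by
  classical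
  by_contra! hcon
  have hf : 1 ≤ f := by omega
  have hcompl : (Finset.univ \ {i} : Finset V).Nonempty := by
    by_contra hne
    have hu : (Finset.univ : Finset V) ⊆ {i} :=
      Finset.sdiff_eq_empty_iff_subset.1 (Finset.not_nonempty_iff_eq_empty.1 hne)
    have : inDeg G i ≤ 1 := by
      simpa [inDeg] using Finset.card_le_card ((Finset.subset_univ (inNbrs G i)).trans hu)
    omega
  -- Robustness is tested on `{i}` and its complement. A node of the complement has at most the
  -- in-neighbour `i` outside, too few as `f ≥ 1`; hence `i` has `2f + 1` in-neighbours.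
  rcases hrobust {i} (Finset.univ \ {i}) (Finset.singleton_nonempty i) hcompl
    (fun h => by simp [h] at hcompl) (fun h => by
      have := h ▸ Finset.mem_univ i
      simp at this) Finset.disjoint_sdiff with ⟨j, hj, hc⟩ | ⟨j, hj, hc⟩
  · rw [Finset.mem_singleton.1 hj] at hc
    have := hc.trans (Finset.card_le_card Finset.sdiff_subset)
    simp only [inDeg] at hcon
    omega
  · have : inNbrs G j \ (Finset.univ \ {i}) ⊆ {i} := by
      intro k hk
      simpa using (Finset.mem_sdiff.1 hk).2
    have := Finset.card_le_card this
    simp only [Finset.card_singleton] at this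
    omega

end PulseSync

/-! ### Executions and the timing of a single node -/

namespace PulseSync

/-- The event `e` is an action of the node `i`. -/
def PEvent.IsOwn {V : Type*} (e : PEvent V) (i : V) : Prop :=
  e = .start i ∨ e = .fire i ∨ e = .update i

namespace Execution

variable {V : Type*} [Fintype V] {G : Digraph V} {F : Finset V} {f : ℕ} {ζ α : ℝ}

/-- The phase of `i` just before event `l`. -/
def phaseBefore (X : Execution G F f ζ α) (i : V) (l : ℕ) : ℝ :=
  ((X.state l i).flow (X.time (l + 1) - X.time l)).phase

theorem phaseBefore_eq (X : Execution G F f ζ α) (i : V) (l : ℕ) :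
    X.phaseBefore i l = (X.state l i).phase + (X.state l i).freq * (X.time (l + 1) - X.time l) :=
  rfl

theorem time_mono (X : Execution G F f ζ α) : Monotone X.time := monotone_nat_of_le_succ X.time_le

theorem lt_of_time_lt (X : Execution G F f ζ α) {k l : ℕ} (h : X.time k < X.time l) : k < l := by
  by_contra! hle
  exact absurd (X.time_mono hle) (not_le.2 h)

/-! ### Single events -/

section Steps

variable (X : Execution G F f ζ α) {i : V} (hi : i ∉ F) {k : ℕ}

include hi

theorem step_quiet (h : ¬ (X.event k).IsOwn i) :
    (X.state (k + 1) i).phase = X.phaseBefore i k ∧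
    (X.state (k + 1) i).freq = (X.state k i).freq ∧
    (X.state (k + 1) i).flag = (X.state k i).flag ∧
    (X.state (k + 1) i).started = (X.state k i).started := by
  have hs := X.step k i hi
  unfold phaseBefore
  simp only [PEvent.IsOwn, not_or] at h
  rcases hev : X.event k with j | j | j <;> simp only [LocalStep, hev] at hs h <;>
    have hj : j ≠ i := fun hj => by simp [hj] at h
  · rw [if_neg hj] at hs
    rw [hs]; split_ifs <;> simp [Osc.hearStart, Osc.flow]
  · rw [if_neg hj] at hs
    rw [hs]; split_ifs <;> simp [Osc.hearEnd, Osc.flow]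
  · rw [if_neg hj] at hs
    rw [hs]; simp [Osc.flow]

theorem step_start (h : X.event k = .start i) :
    (X.state (k + 1) i).phase = X.phaseBefore i k ∧
    (X.state (k + 1) i).freq = (X.state k i).freq ∧
    (X.state (k + 1) i).flag = (X.state k i).flag ∧
    (X.state (k + 1) i).started = true := by
  have hs := X.step k i hi
  unfold phaseBefore
  simp only [LocalStep, h, if_true] at hs
  rw [hs]; split_ifs <;> simp [Osc.hearStart, Osc.flow, Osc.emitStart]

theorem step_fire (h : X.event k = .fire i) :
    (X.state (k + 1) i).phase = 0 ∧
    (X.state (k + 1) i).freq = (X.state k i).freq ∧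
    (X.state (k + 1) i).flag = true ∧
    (X.state (k + 1) i).started = false := by
  have hs := X.step k i hi
  simp only [LocalStep, h, if_true] at hs
  rw [hs]; split_ifs <;> simp [Osc.hearEnd, Osc.flow, Osc.emitEnd]

open Classical in
theorem step_starts (h : X.event k ≠ .update i) :
    (X.state (k + 1) i).starts = if ∃ j, G.Adj i j ∧ X.event k = .start j then
      insert k (X.state k i).starts else (X.state k i).starts := by
  have hs := X.step k i hi
  rcases hev : X.event k with j | j | j <;> simp only [LocalStep, hev] at hs h
  · have e : (∃ j', G.Adj i j' ∧ PEvent.start j = PEvent.start j') ↔ G.Adj i j :=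
      ⟨fun ⟨j', h1, h2⟩ => by injection h2 with h2; rwa [h2], fun h => ⟨j, h, rfl⟩⟩
    simp only [e]
    rw [hs]; split_ifs <;> simp [Osc.hearStart, Osc.flow, Osc.emitStart]
  · rw [if_neg (by simp)]
    rw [hs]; split_ifs <;> simp [Osc.hearEnd, Osc.flow, Osc.emitEnd]
  · rw [if_neg (by simp)]
    rw [if_neg (fun e => h (by rw [e]))] at hs
    rw [hs]; simp [Osc.flow]

open Classical in
theorem step_ends (h : X.event k ≠ .update i) :
    (X.state (k + 1) i).ends = if ∃ j, G.Adj i j ∧ X.event k = .fire j then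
      insert k (X.state k i).ends else (X.state k i).ends := by
  have hs := X.step k i hi
  rcases hev : X.event k with j | j | j <;> simp only [LocalStep, hev] at hs h
  · rw [if_neg (by simp)]
    rw [hs]; split_ifs <;> simp [Osc.hearStart, Osc.flow, Osc.emitStart]
  · have e : (∃ j', G.Adj i j' ∧ PEvent.fire j = PEvent.fire j') ↔ G.Adj i j :=
      ⟨fun ⟨j', h1, h2⟩ => by injection h2 with h2; rwa [h2], fun h => ⟨j, h, rfl⟩⟩
    simp only [e]
    rw [hs]; split_ifs <;> simp [Osc.hearEnd, Osc.flow, Osc.emitEnd]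
  · rw [if_neg (by simp)]
    rw [if_neg (fun e => h (by rw [e]))] at hs
    rw [hs]; simp [Osc.flow]

open Classical in
theorem step_zUp (h : X.event k ≠ .update i) :
    (X.state (k + 1) i).zUp =
      if (∃ j, G.Adj i j ∧ X.event k = .fire j) ∧ (X.state k i).ends.card + 1 = f + 1 then
        (if 1 / 2 ≤ X.phaseBefore i k ∧ X.phaseBefore i k < 1 then 1 - X.phaseBefore i k else 0)
      else (X.state k i).zUp := by
  have hs := X.step k i hi
  unfold phaseBefore
  rcases hev : X.event k with j | j | j <;> simp only [LocalStep, hev] at hs h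
  · rw [if_neg (by simp)]
    rw [hs]; split_ifs <;> simp [Osc.hearStart, Osc.flow, Osc.emitStart]
  · have e : (∃ j', G.Adj i j' ∧ PEvent.fire j = PEvent.fire j') ↔ G.Adj i j :=
      ⟨fun ⟨j', h1, h2⟩ => by injection h2 with h2; rwa [h2], fun h => ⟨j, h, rfl⟩⟩
    simp only [e]
    rw [hs]
    rcases eq_or_ne j i with rfl | hj
    · by_cases hadj : G.Adj j j <;>
        simp [hadj, Osc.hearEnd, Osc.flow, Osc.emitEnd, Osc.count]
    · by_cases hadj : G.Adj i j <;>
        simp [hadj, hj, Osc.hearEnd, Osc.flow, Osc.count]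
  · rw [if_neg (by simp)]
    rw [if_neg (fun e => h (by rw [e]))] at hs
    rw [hs]; simp [Osc.flow]

open Classical in
theorem step_zDown (h : X.event k ≠ .update i) :
    (X.state (k + 1) i).zDown =
      if (∃ j, G.Adj i j ∧ X.event k = .fire j) ∧
          (X.state k i).ends.card + 1 = inDeg G i - f then
        (if 0 ≤ X.phaseBefore i k ∧ X.phaseBefore i k < 1 / 2 then -X.phaseBefore i k else 0)
      else (X.state k i).zDown := by
  have hs := X.step k i hi
  unfold phaseBefore
  rcases hev : X.event k with j | j | j <;> simp only [LocalStep, hev] at hs h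
  · rw [if_neg (by simp)]
    rw [hs]; split_ifs <;> simp [Osc.hearStart, Osc.flow, Osc.emitStart]
  · have e : (∃ j', G.Adj i j' ∧ PEvent.fire j = PEvent.fire j') ↔ G.Adj i j :=
      ⟨fun ⟨j', h1, h2⟩ => by injection h2 with h2; rwa [h2], fun h => ⟨j, h, rfl⟩⟩
    simp only [e]
    rw [hs]
    rcases eq_or_ne j i with rfl | hj
    · by_cases hadj : G.Adj j j <;>
        simp [hadj, Osc.hearEnd, Osc.flow, Osc.emitEnd, Osc.count]
    · by_cases hadj : G.Adj i j <;>
        simp [hadj, hj, Osc.hearEnd, Osc.flow, Osc.count]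
  · rw [if_neg (by simp)]
    rw [if_neg (fun e => h (by rw [e]))] at hs
    rw [hs]; simp [Osc.flow]

end Steps

/-! ### Rounds of a single node -/

section Rounds

variable (X : Execution G F f ζ α) {i : V}

/-- Receptions only touch the recorded pulses and the latched variables, so between its own actions
a node drifts linearly. -/
theorem quiet (hi : i ∉ F) {k₀ k : ℕ} (hk : k₀ ≤ k)
    (h : ∀ l, k₀ ≤ l → l < k → ¬ (X.event l).IsOwn i) :
    (X.state k i).phase = (X.state k₀ i).phase +
      (X.state k₀ i).freq * (X.time k - X.time k₀) ∧
    (X.state k i).freq = (X.state k₀ i).freq ∧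
    (X.state k i).flag = (X.state k₀ i).flag ∧
    (X.state k i).started = (X.state k₀ i).started := by
  induction k, hk using Nat.le_induction with
  | base => simp
  | succ k hk ih =>
    obtain ⟨h1, h2, h3, h4⟩ := ih fun l hl hl' => h l hl (by omega)
    obtain ⟨g1, g2, g3, g4⟩ := X.step_quiet hi (h k hk (by omega))
    refine ⟨?_, g2.trans h2, g3.trans h3, g4.trans h4⟩
    rw [g1, phaseBefore_eq, h1, h2]; ring

/-- A node does not let time pass beyond the instant at which its next action is due. -/
theorem time_le_of_quiet (hi : i ∉ F) {k₀ : ℕ} {q : ℝ} (hω : 0 < (X.state k₀ i).freq)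
    (hq : (X.state k₀ i).phase ≤ q)
    (hready : q = 1 ∨ (q = 1 - ζ ∧ (X.state k₀ i).started = false) ∨
      (q = 1 / 2 ∧ (X.state k₀ i).flag = true))
    {k : ℕ} (hk : k₀ ≤ k) (h : ∀ l, k₀ ≤ l → l < k → ¬ (X.event l).IsOwn i) :
    X.time (k + 1) ≤ X.time k₀ + (q - (X.state k₀ i).phase) / (X.state k₀ i).freq := by
  set T := X.time k₀ + (q - (X.state k₀ i).phase) / (X.state k₀ i).freq with hT
  have hT0 : X.time k₀ ≤ T := by
    have : 0 ≤ (q - (X.state k₀ i).phase) / (X.state k₀ i).freq :=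
      div_nonneg (by linarith) hω.le
    linarith
  induction k, hk using Nat.le_induction with
  | base =>
    by_contra! hlt
    -- At the instant `T`, strictly before the next event, the phase would be `q` with an action
    -- due, against `urgent`.
    refine X.urgent k₀ i hi (T - X.time k₀) (by linarith) (by linarith) ?_
    have : (X.state k₀ i).phase + (X.state k₀ i).freq * (T - X.time k₀) = q := by
      rw [hT]; field_simp; ring
    simpa only [Osc.Ready, Osc.flow, this] using hready
  | succ k hk ih =>
    have hT1 := ih fun l hl hl' => h l hl (by omega)
    by_contra! hlt
    obtain ⟨g1, g2, g3, g4⟩ := X.quiet hi (show k₀ ≤ k + 1 by omega) h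
    refine X.urgent (k + 1) i hi (T - X.time (k + 1)) (by linarith) (by linarith) ?_
    have : (X.state (k + 1) i).phase + (X.state (k + 1) i).freq * (T - X.time (k + 1)) = q := by
      rw [g1, g2, hT]; field_simp; ring
    simpa only [Osc.Ready, Osc.flow, this, g3, g4] using hready

/-- The next action of a node happens no later than its phase reaches a value at which an action
is due. -/
theorem exists_next_own (hi : i ∉ F) {k₀ : ℕ} {q : ℝ} (hω : 0 < (X.state k₀ i).freq)
    (hq : (X.state k₀ i).phase ≤ q)
    (hready : q = 1 ∨ (q = 1 - ζ ∧ (X.state k₀ i).started = false) ∨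
      (q = 1 / 2 ∧ (X.state k₀ i).flag = true)) :
    ∃ k, k₀ ≤ k ∧ (X.event k).IsOwn i ∧ (∀ l, k₀ ≤ l → l < k → ¬ (X.event l).IsOwn i) ∧
      X.phaseBefore i k = (X.state k₀ i).phase +
        (X.state k₀ i).freq * (X.time (k + 1) - X.time k₀) ∧ X.phaseBefore i k ≤ q := by
  classical
  have hex : ∃ k, k₀ ≤ k ∧ (X.event k).IsOwn i := by
    by_contra! hcon
    obtain ⟨n, hn⟩ := (X.time_tendsto.eventually_gt_atTop
      (X.time k₀ + (q - (X.state k₀ i).phase) / (X.state k₀ i).freq)).exists_forall_of_atTop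
    have h1 := X.time_le_of_quiet hi hω hq hready (le_max_left k₀ n) fun l hl _ => hcon l hl
    have h2 := hn (max k₀ n + 1) (by omega)
    linarith
  obtain ⟨h1, h2⟩ := Nat.find_spec hex
  have hmin : ∀ l, k₀ ≤ l → l < Nat.find hex → ¬ (X.event l).IsOwn i :=
    fun l hl hlt ho => Nat.find_min hex hlt ⟨hl, ho⟩
  have h3 := X.time_le_of_quiet hi hω hq hready h1 hmin
  obtain ⟨g1, g2, -, -⟩ := X.quiet hi h1 hmin
  have h4 : X.phaseBefore i (Nat.find hex) = (X.state k₀ i).phase +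
      (X.state k₀ i).freq * (X.time (Nat.find hex + 1) - X.time k₀) := by
    rw [phaseBefore_eq, g1, g2]; ring
  refine ⟨_, h1, h2, hmin, h4, ?_⟩
  rw [h4]
  have := mul_le_mul_of_nonneg_left (sub_le_iff_le_add'.2 h3) hω.le
  rw [mul_div_cancel₀ _ hω.ne'] at this
  linarith

/-- The event index of the next start pulse of `i` from event `k` on. -/
noncomputable def nextStart (X : Execution G F f ζ α) (i : V) (k : ℕ) : ℕ :=
  sInf {l | k ≤ l ∧ X.event l = .start i}

/-- The event index of the next end pulse of `i` from event `k` on. -/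
noncomputable def nextFire (X : Execution G F f ζ α) (i : V) (k : ℕ) : ℕ :=
  sInf {l | k ≤ l ∧ X.event l = .fire i}

/-- The event index of the next update of `i` from event `k` on. -/
noncomputable def nextUpdate (X : Execution G F f ζ α) (i : V) (k : ℕ) : ℕ :=
  sInf {l | k ≤ l ∧ X.event l = .update i}

/-- The time at which the phase of `i`, growing at its frequency after event `k`, reaches `1`. -/
noncomputable def fireTime (X : Execution G F f ζ α) (i : V) (k : ℕ) : ℝ :=
  X.time k + (1 - (X.state k i).phase) / (X.state k i).freq

/-- From event `k` on, node `i` emits a start pulse, emits an end pulse and performs an update, each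
at the due time, without any other action in between. -/
structure IsRound (X : Execution G F f ζ α) (i : V) (k : ℕ) : Prop where
  le_start : k ≤ X.nextStart i k
  start_lt : X.nextStart i k < X.nextFire i k
  fire_lt : X.nextFire i k < X.nextUpdate i k
  event_start : X.event (X.nextStart i k) = .start i
  event_fire : X.event (X.nextFire i k) = .fire i
  event_update : X.event (X.nextUpdate i k) = .update i
  own : ∀ l, k ≤ l → l ≤ X.nextUpdate i k → (X.event l).IsOwn i →
    l = X.nextStart i k ∨ l = X.nextFire i k ∨ l = X.nextUpdate i k
  time_start : X.time (X.nextStart i k + 1) = X.fireTime i k - ζ / (X.state k i).freq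
  time_fire : X.time (X.nextFire i k + 1) = X.fireTime i k
  time_update : X.time (X.nextUpdate i k + 1) = X.fireTime i k + 1 / (2 * (X.state k i).freq)
  phase_before_fire : ∀ l, k ≤ l → l ≤ X.nextFire i k →
    (X.state l i).phase = 1 - (X.state k i).freq * (X.fireTime i k - X.time l)
  phase_after_fire : ∀ l, X.nextFire i k < l → l ≤ X.nextUpdate i k →
    (X.state l i).phase = (X.state k i).freq * (X.time l - X.fireTime i k)
  freq_eq : ∀ l, k ≤ l → l ≤ X.nextUpdate i k → (X.state l i).freq = (X.state k i).freq
  flag_false : ∀ l, k ≤ l → l ≤ X.nextFire i k → (X.state l i).flag = false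
  started_false : (X.state (X.nextUpdate i k) i).started = false

/-- The order of actions is forced. The first cannot be a firing, as the phase is at most `1 - ζ`,
nor an update, as the flag is down. After the start pulse, `started` excludes a second one and the
flag still excludes an update. After the firing, the phase is at most `1 / 2 < 1 - ζ` until the
update, which excludes both pulses. -/
theorem isRound (hi : i ∉ F) (hζ : 0 < ζ) (hζ' : ζ < 1 / 2) {k₀ : ℕ}
    (hω : 0 < (X.state k₀ i).freq) (hp : (X.state k₀ i).phase ≤ 1 - ζ)
    (hflag : (X.state k₀ i).flag = false) (hstarted : (X.state k₀ i).started = false) :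
    X.IsRound i k₀ := by
  obtain ⟨S, hS, oS, nS, pS, qS⟩ := X.exists_next_own hi hω hp (Or.inr (Or.inl ⟨rfl, hstarted⟩))
  obtain ⟨aS, bS, cS, dS⟩ := X.quiet hi hS nS
  have eS : X.event S = .start i := by
    rcases oS with h | h | h
    · exact h
    · have : X.phaseBefore i S = 1 := X.fire_ok S i hi h
      linarith
    · have := (X.update_ok S i h).2.2
      rw [cS, hflag] at this
      exact absurd this (by simp)
  have vS : X.phaseBefore i S = 1 - ζ := (X.start_ok S i hi eS).1
  obtain ⟨a1, b1, c1, d1⟩ := X.step_start hi eS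
  rw [vS] at a1
  rw [bS] at b1
  rw [cS, hflag] at c1
  obtain ⟨Q, hQ, oQ, nQ, pQ, qQ⟩ := X.exists_next_own hi (k₀ := S + 1) (q := 1) (by rwa [b1])
    (by rw [a1]; linarith) (Or.inl rfl)
  obtain ⟨aQ, bQ, cQ, dQ⟩ := X.quiet hi hQ nQ
  have eQ : X.event Q = .fire i := by
    rcases oQ with h | h | h
    · have := (X.start_ok Q i hi h).2
      rw [dQ, d1] at this
      exact absurd this (by simp)
    · exact h
    · have := (X.update_ok Q i h).2.2
      rw [cQ, c1] at this
      exact absurd this (by simp)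
  have vQ : X.phaseBefore i Q = 1 := X.fire_ok Q i hi eQ
  obtain ⟨a2, b2, c2, d2⟩ := X.step_fire hi eQ
  rw [bQ, b1] at b2
  obtain ⟨U, hU, oU, nU, pU, qU⟩ := X.exists_next_own hi (k₀ := Q + 1) (q := 1 / 2) (by rwa [b2])
    (by rw [a2]; norm_num) (Or.inr (Or.inr ⟨rfl, c2⟩))
  obtain ⟨aU, bU, cU, dU⟩ := X.quiet hi hU nU
  have eU : X.event U = .update i := by
    rcases oU with h | h | h
    · have : X.phaseBefore i U = 1 - ζ := (X.start_ok U i hi h).1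
      linarith
    · have : X.phaseBefore i U = 1 := X.fire_ok U i hi h
      linarith
    · exact h
  have vU : X.phaseBefore i U = 1 / 2 := (X.update_ok U i eU).2.1
  set ω := (X.state k₀ i).freq with hωdef
  have own : ∀ l, k₀ ≤ l → l ≤ U → (X.event l).IsOwn i → l = S ∨ l = Q ∨ l = U := by
    intro l hl hlU ho
    by_contra! hne
    rcases lt_or_ge l S with h | h
    · exact nS l hl h ho
    rcases lt_or_ge l Q with h' | h'
    · exact nQ l (by omega) h' ho
    · exact nU l (by omega) (by omega) ho
  have fS : X.nextStart i k₀ = S := by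
    refine IsLeast.csInf_eq ⟨⟨hS, eS⟩, fun l hl => ?_⟩
    by_contra! hlt
    exact nS l hl.1 hlt (Or.inl hl.2)
  have fQ : X.nextFire i k₀ = Q := by
    refine IsLeast.csInf_eq ⟨⟨by omega, eQ⟩, fun l hl => ?_⟩
    by_contra! hlt
    rcases own l hl.1 (by omega) (Or.inr (Or.inl hl.2)) with h | h | h
    · have := h ▸ hl.2
      rw [eS] at this
      exact absurd this (by simp)
    · omega
    · omega
  have fU : X.nextUpdate i k₀ = U := by
    refine IsLeast.csInf_eq ⟨⟨by omega, eU⟩, fun l hl => ?_⟩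
    by_contra! hlt
    rcases own l hl.1 (by omega) (Or.inr (Or.inr hl.2)) with h | h | h
    · have := h ▸ hl.2
      rw [eS] at this
      exact absurd this (by simp)
    · have := h ▸ hl.2
      rw [eQ] at this
      exact absurd this (by simp)
    · omega
  have fT : X.fireTime i k₀ = X.time k₀ + (1 - (X.state k₀ i).phase) / ω := rfl
  have tS : X.time (S + 1) = X.fireTime i k₀ - ζ / ω := by
    rw [vS] at pS
    rw [fT]; field_simp; linarith
  have tQ : X.time (Q + 1) = X.fireTime i k₀ := by
    rw [vQ, a1, b1, tS] at pQ
    refine mul_left_cancel₀ hω.ne' ?_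
    have : ω * (ζ / ω) = ζ := mul_div_cancel₀ _ hω.ne'
    linarith
  have tU : X.time (U + 1) = X.fireTime i k₀ + 1 / (2 * ω) := by
    rw [vU, a2, b2, tQ] at pU
    field_simp; linarith
  refine ⟨?_, ?_, ?_, ?_, ?_, ?_, ?_, ?_, ?_, ?_, ?_, ?_, ?_, ?_, ?_⟩ <;>
    simp only [fS, fQ, fU]
  · exact hS
  · omega
  · omega
  · exact eS
  · exact eQ
  · exact eU
  · exact own
  · exact tS
  · exact tQ
  · exact tU
  · intro l hl hlQ
    rcases lt_or_ge S l with h | h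
    · obtain ⟨g, -⟩ := X.quiet hi (show S + 1 ≤ l from h) fun m hm hm' => nQ m hm (by omega)
      rw [g, a1, b1, tS]; field_simp; ring
    · obtain ⟨g, -⟩ := X.quiet hi hl fun m hm hm' => nS m hm (by omega)
      rw [g, fT]; field_simp; ring
  · intro l hl hlU
    obtain ⟨g, -⟩ := X.quiet hi (show Q + 1 ≤ l from hl) fun m hm hm' => nU m hm (by omega)
    rw [g, a2, b2, tQ]; ring
  · intro l hl hlU
    rcases lt_or_ge Q l with h' | h'
    · obtain ⟨-, g, -⟩ := X.quiet hi (show Q + 1 ≤ l from h') fun m hm hm' => nU m hm (by omega)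
      rw [g, b2]
    rcases lt_or_ge S l with h | h
    · obtain ⟨-, g, -⟩ := X.quiet hi (show S + 1 ≤ l from h) fun m hm hm' => nQ m hm (by omega)
      rw [g, b1]
    · exact (X.quiet hi hl fun m hm hm' => nS m hm (by omega)).2.1
  · intro l hl hlQ
    rcases lt_or_ge S l with h | h
    · obtain ⟨-, -, g, -⟩ := X.quiet hi (show S + 1 ≤ l from h) fun m hm hm' =>
        nQ m hm (by omega)
      rw [g, c1]
    · obtain ⟨-, -, g, -⟩ := X.quiet hi hl fun m hm hm' => nS m hm (by omega)
      rw [g, hflag]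
  · rw [dU, d2]

end Rounds

/-! ### The pulses received in a round -/

section Pulses

variable (X : Execution G F f ζ α) {i : V}

open Classical in
/-- The end pulses received by `i` from event `k₀` on and before event `k`. -/
noncomputable def pulses (X : Execution G F f ζ α) (i : V) (k₀ k : ℕ) : Finset ℕ :=
  (Finset.Ico k₀ k).filter fun l => ∃ j, G.Adj i j ∧ X.event l = .fire j

theorem mem_pulses {k₀ k l : ℕ} :
    l ∈ X.pulses i k₀ k ↔ k₀ ≤ l ∧ l < k ∧ ∃ j, G.Adj i j ∧ X.event l = .fire j := by
  simp [pulses, and_assoc]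

open Classical in
theorem pulses_succ {k₀ k : ℕ} (hk : k₀ ≤ k) : X.pulses i k₀ (k + 1) =
    if ∃ j, G.Adj i j ∧ X.event k = .fire j then insert k (X.pulses i k₀ k)
    else X.pulses i k₀ k := by
  rw [pulses, ← Finset.insert_Ico_right_eq_Ico_add_one hk, Finset.filter_insert]
  rfl

theorem ends_eq_pulses (hi : i ∉ F) {k₀ k : ℕ} (hk : k₀ ≤ k)
    (h0 : (X.state k₀ i).ends = ∅) (h : ∀ l, k₀ ≤ l → l < k → X.event l ≠ .update i) :
    (X.state k i).ends = X.pulses i k₀ k := by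
  classical
  induction k, hk using Nat.le_induction with
  | base => simp [h0, pulses]
  | succ k hk ih =>
    rw [X.step_ends hi (h k hk (by omega)), ih fun l hl hl' => h l hl (by omega),
      X.pulses_succ hk]

theorem mem_starts (hi : i ∉ F) {k₀ k : ℕ} (hk : k₀ ≤ k)
    (h0 : (X.state k₀ i).starts = ∅) (h : ∀ l, k₀ ≤ l → l < k → X.event l ≠ .update i) {l : ℕ} :
    l ∈ (X.state k i).starts ↔ k₀ ≤ l ∧ l < k ∧ ∃ j, G.Adj i j ∧ X.event l = .start j := by
  classical
  induction k, hk using Nat.le_induction with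
  | base => simp only [h0, Finset.notMem_empty, false_iff]; omega
  | succ k hk ih =>
    have ih := ih fun l hl hl' => h l hl (by omega)
    rw [X.step_starts hi (h k hk (by omega))]
    split_ifs with hj
    · rw [Finset.mem_insert, ih]
      constructor
      · rintro (rfl | h)
        · exact ⟨hk, by omega, hj⟩
        · exact ⟨h.1, by omega, h.2.2⟩
      · rintro ⟨h1, h2, h3⟩
        by_cases h4 : l = k
        · exact Or.inl h4
        · exact Or.inr ⟨h1, by omega, h3⟩
    · rw [ih]
      constructor
      · rintro ⟨h1, h2, h3⟩
        exact ⟨h1, by omega, h3⟩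
      · rintro ⟨h1, h2, h3⟩
        by_cases h4 : l = k
        · subst h4
          exact absurd h3 hj
        · exact ⟨h1, by omega, h3⟩

open Classical in
/-- A variable that is set on reception of the `n`-th end pulse only. -/
theorem latched {k₀ k : ℕ} (hk : k₀ ≤ k) (Z g : ℕ → ℝ) (n : ℕ)
    (hZ : ∀ l, k₀ ≤ l → l < k → Z (l + 1) =
      if (∃ j, G.Adj i j ∧ X.event l = .fire j) ∧ (X.pulses i k₀ l).card + 1 = n then g l
      else Z l) :
    ((X.pulses i k₀ k).card < n ∨ n = 0 → Z k = Z k₀) ∧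
    (1 ≤ n → n ≤ (X.pulses i k₀ k).card →
      ∃ b ∈ X.pulses i k₀ k, (X.pulses i k₀ b).card + 1 = n ∧ Z k = g b) := by
  induction k, hk using Nat.le_induction with
  | base => exact ⟨fun _ => rfl, fun h1 h2 => by simp [pulses] at h2; omega⟩
  | succ k hk ih =>
    obtain ⟨ih1, ih2⟩ := ih fun l hl hl' => hZ l hl (by omega)
    have hk' := hZ k hk (by omega)
    have hnot : k ∉ X.pulses i k₀ k := by simp [pulses]
    rw [X.pulses_succ hk]
    by_cases hj : ∃ j, G.Adj i j ∧ X.event k = .fire j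
    · rw [if_pos hj, Finset.card_insert_of_notMem hnot]
      by_cases hc : (X.pulses i k₀ k).card + 1 = n
      · rw [if_pos ⟨hj, hc⟩] at hk'
        exact ⟨fun h => by omega, fun _ _ => ⟨k, Finset.mem_insert_self _ _, hc, hk'⟩⟩
      · rw [if_neg (fun h => hc h.2)] at hk'
        rw [hk']
        refine ⟨fun h => ih1 (by omega), fun h1 h2 => ?_⟩
        obtain ⟨b, hb, h3⟩ := ih2 h1 (by omega)
        exact ⟨b, Finset.mem_insert_of_mem hb, h3⟩
    · rw [if_neg (fun h => hj h.1)] at hk'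
      rw [if_neg hj, hk']
      exact ⟨ih1, ih2⟩

end Pulses

end Execution

end PulseSync

namespace PulseSync

/-! ### Trimmed averages -/

/-- A retained value above `M` would form, with the `m` removed top values, `m + 1` bad ones. Of `m
+ 1` low good values at most `m` are removed at the bottom, so some retained value is low too.
Either this one or `x` carries weight at least `α`. -/
theorem IsTrimming.avg_le {E J good : Finset ℕ} {m : ℕ} {v w : ℕ → ℝ} {a α x M ε : ℝ}
    (hT : IsTrimming v E m J) (hsub : good ⊆ E) (hbad : (E \ good).card ≤ m) (hα : 0 ≤ α)
    (ha : α ≤ a) (hw : ∀ l ∈ J, α ≤ w l) (hsum : a + ∑ l ∈ J, w l = 1) (hε : 0 ≤ ε)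
    (hM : ∀ l ∈ good, v l ≤ M) (hx : x ≤ M)
    (hlow : x ≤ M - ε ∨
      (2 * m < E.card ∧ m + 1 ≤ (good.filter (fun l => v l ≤ M - ε)).card)) :
    a * x + ∑ l ∈ J, w l * v l ≤ M - α * ε := by
  classical
  have hJM : ∀ l ∈ J, v l ≤ M := by
    intro l hl
    rcases hT with ⟨-, rfl⟩ | ⟨L, U, hL, hU, -, hUJ, -, hE, -, hUtop⟩
    · simp at hl
    by_contra! hlt
    have hsub' : insert l U ⊆ E \ good := by
      intro u hu
      rw [Finset.mem_sdiff, ← hE]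
      rcases Finset.mem_insert.1 hu with rfl | hu
      · exact ⟨by simp [hl], fun hg => absurd (hM _ hg) (not_le.2 hlt)⟩
      · refine ⟨by simp [hu], fun hg => ?_⟩
        have h1 := hM _ hg
        have h2 := hUtop u hu l (by simp [hl])
        linarith
    have h1 := Finset.card_le_card hsub'
    rw [Finset.card_insert_of_notMem (Finset.disjoint_right.1 hUJ hl), hU] at h1
    omega
  have hle : ∑ l ∈ J, w l * v l ≤ (∑ l ∈ J, w l) * M := by
    rw [Finset.sum_mul]
    exact Finset.sum_le_sum fun l hl =>
      mul_le_mul_of_nonneg_left (hJM l hl) (hα.trans (hw l hl))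
  have hS : ∑ l ∈ J, w l = 1 - a := by linarith
  have ha0 : 0 ≤ a := hα.trans ha
  have hαa := mul_le_mul_of_nonneg_right ha hε
  rcases hlow with hlow | ⟨hcard, hlow⟩
  · have := mul_le_mul_of_nonneg_left hlow ha0
    rw [hS] at hle
    linarith
  · obtain ⟨l, hl, hvl⟩ : ∃ l ∈ J, v l ≤ M - ε := by
      rcases hT with ⟨h, -⟩ | ⟨L, U, hL, hU, -, -, -, hE, -, hUtop⟩
      · omega
      obtain ⟨h, hh, hhL⟩ : ∃ h ∈ good.filter (fun l => v l ≤ M - ε), h ∉ L := by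
        by_contra! hcon
        have := Finset.card_le_card hcon
        omega
      obtain ⟨hg, hv⟩ := Finset.mem_filter.1 hh
      have hhE := hsub hg
      rw [← hE, Finset.mem_union, Finset.mem_union] at hhE
      rcases hhE with (h1 | h1) | h1
      · exact absurd h1 hhL
      · exact ⟨h, h1, hv⟩
      -- A low value among the removed top ones lies above all of `J`; it remains to see that `J` is
      -- inhabited, by `2 * m < E.card`.
      · have hJ : J.Nonempty := by
          rw [Finset.nonempty_iff_ne_empty]
          rintro rfl
          have h2 := Finset.card_union_le L U
          rw [Finset.union_empty] at hE
          rw [hE] at h2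
          omega
        obtain ⟨l, hl⟩ := hJ
        exact ⟨l, hl, (hUtop h h1 l (by simp [hl])).trans hv⟩
    have hsplit := Finset.add_sum_erase J (fun l => w l * v l) hl
    have hsplit' := Finset.add_sum_erase J w hl
    have hrest : ∑ l ∈ J.erase l, w l * v l ≤ (∑ l ∈ J.erase l, w l) * M := by
      rw [Finset.sum_mul]
      exact Finset.sum_le_sum fun l hl =>
        mul_le_mul_of_nonneg_left (hJM l (Finset.mem_of_mem_erase hl))
          (hα.trans (hw l (Finset.mem_of_mem_erase hl)))
    have h1 := mul_le_mul_of_nonneg_left hvl (hα.trans (hw l hl))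
    have h2 := mul_le_mul_of_nonneg_right (hw l hl) hε
    have h3 := mul_le_mul_of_nonneg_left hx ha0
    have h4 : ∑ l ∈ J.erase l, w l = 1 - a - w l := by linarith
    rw [h4] at hrest
    linarith

/-- Trimming treats both ends alike, so lower bounds reduce to upper bounds. -/
theorem IsTrimming.neg {v : ℕ → ℝ} {P J : Finset ℕ} {m : ℕ} (h : IsTrimming v P m J) :
    IsTrimming (fun l => -v l) P m J := by
  classical
  rcases h with h | ⟨L, U, hL, hU, h1, h2, h3, h4, h5, h6⟩
  · exact Or.inl h
  · refine Or.inr ⟨U, L, hU, hL, h2, h1, h3.symm, ?_, fun l hl x hx => ?_, fun l hl x hx => ?_⟩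
    · rw [← h4]
      ext x
      simp only [Finset.mem_union]
      tauto
    · exact neg_le_neg (h6 l hl x (by rw [Finset.union_comm]; exact hx))
    · exact neg_le_neg (h5 l hl x (by rw [Finset.union_comm]; exact hx))

/-- This passes from relative to absolute frequencies, with `c` the frequency of the receiver. -/
theorem IsTrimming.mul_right {v : ℕ → ℝ} {P J : Finset ℕ} {m : ℕ} (h : IsTrimming v P m J) {c : ℝ}
    (hc : 0 ≤ c) : IsTrimming (fun l => v l * c) P m J := by
  rcases h with h | ⟨L, U, hL, hU, h1, h2, h3, h4, h5, h6⟩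
  · exact Or.inl h
  · exact Or.inr ⟨L, U, hL, hU, h1, h2, h3, h4,
      fun l hl x hx => mul_le_mul_of_nonneg_right (h5 l hl x hx) hc,
      fun l hl x hx => mul_le_mul_of_nonneg_right (h6 l hl x hx) hc⟩

/-! ### End pulses received in one round -/

section Reception

variable {V : Type*} [Fintype V] {G : Digraph V} {F : Finset V} {f : ℕ}

open Classical in
/-- `E` is the set of end pulses that the normal node `i` of in-degree `d` received in a round, the
pulse of its normal in-neighbour `j` being `p j`; no more than `d` pulses are received, and the
pulses of misbehaving nodes are not more than the removal rule accounts for. -/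
structure IsReception (G : Digraph V) (F : Finset V) (f : ℕ) (i : V) (E : Finset ℕ) (p : V → ℕ) :
    Prop where
  mem : ∀ j ∈ inNbrs G i \ F, p j ∈ E
  inj : Set.InjOn p (inNbrs G i \ F : Finset V)
  card_le : E.card ≤ inDeg G i
  card_normal : inDeg G i ≤ (inNbrs G i \ F).card + f
  card_bad : (E \ (inNbrs G i \ F).image p).card ≤ f - (inDeg G i - E.card)

-- At least `d - f` pulses come from normal in-neighbours, so at most `|E| - (d - f)` are forged;
-- for `|E| ≤ d` this is the removal number `f - (d - |E|)`. Without misbehaving in-neighbours no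
-- pulse is forged and `|E| ≤ d` is automatic.
open Classical in
theorem isReception (hlocal : IsLocalAttack G F f) {i : V} (hi : i ∉ F) {E : Finset ℕ} {p : V → ℕ}
    (mem : ∀ j ∈ inNbrs G i \ F, p j ∈ E) (inj : Set.InjOn p (inNbrs G i \ F : Finset V))
    (sender : ∀ l ∈ E, ∃ j, G.Adj i j ∧ (j ∉ F → l = p j))
    (hcard : (∃ j ∈ F, G.Adj i j) → E.card ≤ inDeg G i) : IsReception G F f i E p := by
  have h1 : (inNbrs G i \ F).card + (F ∩ inNbrs G i).card = inDeg G i := by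
    rw [Finset.inter_comm, Finset.card_sdiff_add_card_inter]; rfl
  have h2 := hlocal i hi
  have hsub : (inNbrs G i \ F).image p ⊆ E := by
    intro l hl
    obtain ⟨j, hj, rfl⟩ := Finset.mem_image.1 hl
    exact mem j hj
  have h3 := Finset.card_sdiff_add_card_eq_card hsub
  rw [Finset.card_image_of_injOn inj] at h3
  have hle : E.card ≤ inDeg G i := by
    by_cases h : ∃ j ∈ F, G.Adj i j
    · exact hcard h
    push Not at h
    have hbad : E \ (inNbrs G i \ F).image p = ∅ := by
      refine Finset.sdiff_eq_empty_iff_subset.2 fun l hl => ?_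
      obtain ⟨j, hj, hp⟩ := sender l hl
      have hjF : j ∉ F := fun hF => h j hF hj
      exact Finset.mem_image.2 ⟨j, by simp [inNbrs, hj, hjF], (hp hjF).symm⟩
    rw [hbad, Finset.card_empty] at h3
    omega
  exact ⟨mem, inj, hle, by omega, by omega⟩

namespace IsReception

variable {i : V} {E : Finset ℕ} {p : V → ℕ}

open Classical in
theorem card_normal_le (h : IsReception G F f i E p) : (inNbrs G i \ F).card ≤ E.card := by
  rw [← Finset.card_image_of_injOn h.inj]
  refine Finset.card_le_card fun l hl => ?_
  obtain ⟨j, hj, rfl⟩ := Finset.mem_image.1 hl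
  exact h.mem j hj

open Classical in
/-- A pulse preceded by at least `f` others is not earlier than all pulses of normal nodes. -/
theorem exists_le (h : IsReception G F f i E p) {b : ℕ} (hb : b ∈ E)
    (hf : f ≤ (E.filter (· < b)).card) : ∃ j ∈ inNbrs G i \ F, p j ≤ b := by
  by_contra! hcon
  -- Otherwise `b` and the pulses before it would be `f + 1` forged ones.
  have hsub : insert b (E.filter (· < b)) ⊆ E \ (inNbrs G i \ F).image p := by
    intro l hl
    have hle : l ∈ E ∧ l ≤ b := by
      rcases Finset.mem_insert.1 hl with rfl | hl
      · exact ⟨hb, le_rfl⟩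
      · exact ⟨(Finset.mem_filter.1 hl).1, (Finset.mem_filter.1 hl).2.le⟩
    refine Finset.mem_sdiff.2 ⟨hle.1, fun hl' => ?_⟩
    obtain ⟨j, hj, rfl⟩ := Finset.mem_image.1 hl'
    exact absurd (hcon j hj) (not_lt.2 hle.2)
  have h1 := Finset.card_le_card hsub
  rw [Finset.card_insert_of_notMem (by simp)] at h1
  have := h.card_bad
  omega

-- Pigeonhole: too few pulses precede `b` to include those of all senders in `P`.
open Classical in
theorem le_of_card (h : IsReception G F f i E p) {b : ℕ} {P : V → Prop}
    (hc : (E.filter (· < b)).card < ((inNbrs G i \ F).filter P).card) :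
    ∃ j ∈ inNbrs G i \ F, P j ∧ b ≤ p j := by
  by_contra! hcon
  have hsub : ((inNbrs G i \ F).filter P).image p ⊆ E.filter (· < b) := by
    intro l hl
    obtain ⟨j, hj, rfl⟩ := Finset.mem_image.1 hl
    obtain ⟨hj, hP⟩ := Finset.mem_filter.1 hj
    exact Finset.mem_filter.2 ⟨h.mem j hj, hcon j hj hP⟩
  have h1 := Finset.card_le_card hsub
  rw [Finset.card_image_of_injOn (h.inj.mono fun j hj => (Finset.mem_filter.1 hj).1)] at h1
  omega

-- Pigeonhole: were all pulses of senders in `P` later than `b`, then together with those up to `b`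
-- they would outnumber the in-degree.
open Classical in
theorem ge_of_card (h : IsReception G F f i E p) {b : ℕ} (hb : b ∈ E) {P : V → Prop}
    (hc : inDeg G i < (E.filter (· < b)).card + 1 + ((inNbrs G i \ F).filter P).card) :
    ∃ j ∈ inNbrs G i \ F, P j ∧ p j ≤ b := by
  by_contra! hcon
  have hdisj : Disjoint (((inNbrs G i \ F).filter P).image p) (insert b (E.filter (· < b))) := by
    rw [Finset.disjoint_left]
    intro l hl hl'
    obtain ⟨j, hj, rfl⟩ := Finset.mem_image.1 hl
    obtain ⟨hj, hP⟩ := Finset.mem_filter.1 hj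
    have := hcon j hj hP
    rcases Finset.mem_insert.1 hl' with hl | hl
    · omega
    · have := (Finset.mem_filter.1 hl).2
      omega
  have hsub : ((inNbrs G i \ F).filter P).image p ∪ insert b (E.filter (· < b)) ⊆ E := by
    intro l hl
    rcases Finset.mem_union.1 hl with hl | hl
    · obtain ⟨j, hj, rfl⟩ := Finset.mem_image.1 hl
      exact h.mem j (Finset.mem_filter.1 hj).1
    · rcases Finset.mem_insert.1 hl with rfl | hl
      · exact hb
      · exact (Finset.mem_filter.1 hl).1
  have h1 := Finset.card_le_card hsub
  rw [Finset.card_union_of_disjoint hdisj,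
    Finset.card_image_of_injOn (h.inj.mono fun j hj => (Finset.mem_filter.1 hj).1),
    Finset.card_insert_of_notMem (by simp)] at h1
  have := h.card_le
  omega

open Classical in
/-- The frequency update: trimmed averages of the values of the received pulses. -/
theorem attractsAt_avg (h : IsReception G F f i E p) (hi : i ∉ F)
    (hd : inDeg G i ≤ f ∨ 2 * f + 1 ≤ inDeg G i) {α a : ℝ} {v w : ℕ → ℝ} {J : Finset ℕ}
    {x : V → ℝ} (hv : ∀ j ∈ inNbrs G i \ F, v (p j) = x j)
    (hT : IsTrimming v E (f - (inDeg G i - E.card)) J) (hα : 0 ≤ α) (ha : α ≤ a)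
    (hw : ∀ l ∈ J, α ≤ w l) (hsum : a + ∑ l ∈ J, w l = 1) :
    AttractsAt G F f α x i (a * x i + ∑ l ∈ J, w l * v l) := by
  intro M ε hε hM hlow
  have hsub : (inNbrs G i \ F).image p ⊆ E := by
    intro l hl
    obtain ⟨j, hj, rfl⟩ := Finset.mem_image.1 hl
    exact h.mem j hj
  refine hT.avg_le hsub h.card_bad hα ha hw hsum hε (fun l hl => ?_) (hM i hi) (hlow.imp_right ?_)
  · obtain ⟨j, hj, rfl⟩ := Finset.mem_image.1 hl
    rw [hv j hj]
    exact hM j (Finset.mem_sdiff.1 hj).2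
  · intro hlow
    have h1 := h.card_le
    have h2 := h.card_normal
    have h3 := h.card_normal_le
    -- By the dichotomy the in-degree is then at least `2f + 1`, so trimming leaves something over.
    have h4 : f + 1 ≤ inDeg G i := hlow.trans (Finset.card_le_card fun j hj =>
      (Finset.mem_sdiff.1 (Finset.mem_filter.1 hj).1).1)
    refine ⟨by omega, ?_⟩
    have h5 : ((inNbrs G i \ F).filter (fun j => x j ≤ M - ε)).image p ⊆
        ((inNbrs G i \ F).image p).filter (fun l => v l ≤ M - ε) := by
      intro l hl
      obtain ⟨j, hj, rfl⟩ := Finset.mem_image.1 hl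
      obtain ⟨hj, hx⟩ := Finset.mem_filter.1 hj
      exact Finset.mem_filter.2 ⟨Finset.mem_image_of_mem _ hj, by rwa [hv j hj]⟩
    have h6 := Finset.card_le_card h5
    rw [Finset.card_image_of_injOn (h.inj.mono fun j hj => (Finset.mem_filter.1 hj).1)] at h6
    omega

open Classical in
/-- The phase update: the mean of the earlier of the own firing and the `(f+1)`-st pulse and the
later of the own firing and the `(d-f)`-th pulse. -/
theorem attractsAt_mid (h : IsReception G F f i E p) (hi : i ∉ F)
    {T : ℕ → ℝ} (hT : Monotone T) {b₁ b₂ : ℕ} (hb₁ : b₁ ∈ E) (hb₂ : b₂ ∈ E)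
    (hc₁ : (E.filter (· < b₁)).card + 1 = f + 1)
    (hc₂ : (E.filter (· < b₂)).card + 1 = inDeg G i - f) {x : V → ℝ}
    (hx : ∀ j, j ∉ F → x j = T (p j)) :
    AttractsAt G F f (1 / 2) x i ((min (x i) (T b₁) + max (x i) (T b₂)) / 2) ∧
    AttractsAt G F f (1 / 2) (-x) i (-((min (x i) (T b₁) + max (x i) (T b₂)) / 2)) := by
  have hn := h.card_normal
  have hF : ∀ j ∈ inNbrs G i \ F, j ∉ F := fun j hj => (Finset.mem_sdiff.1 hj).2
  constructor
  · intro M ε hε hM hlow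
    -- Only `d - f - 1` pulses precede `b₂`, fewer than the normal ones, so some normal pulse is not
    -- earlier.
    have h2 : max (x i) (T b₂) ≤ M := by
      refine max_le (hM i hi) ?_
      obtain ⟨j, hj, -, hle⟩ := h.le_of_card (b := b₂) (P := fun _ => True)
        (by rw [Finset.filter_true]; omega)
      exact (hT hle).trans ((hx j (hF j hj)).symm.le.trans (hM j (hF j hj)))
    -- Only `f` pulses precede `b₁`, so one of the `f + 1` early normal pulses does not.
    have h1 : min (x i) (T b₁) ≤ M - ε := by
      rcases hlow with hlow | hlow
      · exact (min_le_left _ _).trans hlow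
      · obtain ⟨j, hj, hP, hle⟩ := h.le_of_card (b := b₁) (P := fun j => x j ≤ M - ε) (by omega)
        exact (min_le_right _ _).trans ((hT hle).trans ((hx j (hF j hj)).symm.le.trans hP))
    linarith
  · intro M ε hε hM hlow
    have h1 : -M ≤ min (x i) (T b₁) := by
      refine le_min (by have := hM i hi; simp only [Pi.neg_apply] at this; linarith) ?_
      obtain ⟨j, hj, hle⟩ := h.exists_le hb₁ (by omega)
      have h3 := hM j (hF j hj)
      have h4 := hT hle
      rw [← hx j (hF j hj)] at h4
      simp only [Pi.neg_apply] at h3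
      linarith
    -- The `d - f` pulses up to `b₂` and the `f + 1` late normal ones number more than `d`, so they
    -- overlap.
    have h2 : ε - M ≤ max (x i) (T b₂) := by
      rcases hlow with hlow | hlow
      · refine le_max_of_le_left ?_
        simp only [Pi.neg_apply] at hlow
        linarith
      · obtain ⟨j, hj, hP, hle⟩ := h.ge_of_card hb₂ (P := fun j => (-x) j ≤ M - ε) (by omega)
        have h4 := hT hle
        rw [← hx j (hF j hj)] at h4
        refine le_max_of_le_right ?_
        simp only [Pi.neg_apply] at hP
        linarith
    linarith

end IsReception

end Reception

end PulseSync

/-! ### One common round of the normal nodes -/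

namespace PulseSync
namespace Execution

variable {V : Type*} [Fintype V] {G : Digraph V} {F : Finset V} {f : ℕ} {ζ α : ℝ}

/-- The start of a common round of all normal nodes: node `i` starts its round after event
`k i`, the rounds are well separated by the pulses, and frequencies lie in `[1, 1 + δ]`. -/
structure IsRoundStart (X : Execution G F f ζ α) (δ : ℝ) (k : V → ℕ) : Prop where
  flag : ∀ i, i ∉ F → (X.state (k i) i).flag = false
  started : ∀ i, i ∉ F → (X.state (k i) i).started = false
  starts : ∀ i, i ∉ F → (X.state (k i) i).starts = ∅
  ends : ∀ i, i ∉ F → (X.state (k i) i).ends = ∅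
  idle : ∀ i, i ∉ F → inDeg G i ≤ f → (X.state (k i) i).zUp = 0 ∧ (X.state (k i) i).zDown = 0
  phase_nonneg : ∀ i, i ∉ F → 0 ≤ (X.state (k i) i).phase
  phase_le : ∀ i, i ∉ F → (X.state (k i) i).phase ≤ 1 - ζ
  one_le_freq : ∀ i, i ∉ F → 1 ≤ (X.state (k i) i).freq
  freq_le : ∀ i, i ∉ F → (X.state (k i) i).freq ≤ 1 + δ
  le_start : ∀ i j, i ∉ F → j ∉ F → k i ≤ X.nextStart j (k j)
  silent : ∀ i j, i ∉ F → j ∉ F → ∀ l, k i ≤ l → l < k j →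
    X.event l ≠ .start j ∧ X.event l ≠ .fire j

/-- No normal node with a misbehaving in-neighbour reports an attack. -/
def Undetected (X : Execution G F f ζ α) : Prop :=
  ∀ k i, X.Detects k i → ¬ ∃ j ∈ F, G.Adj i j

/-- The firing time towards which the phase update of the round starting after event `k` aims. -/
noncomputable def aimTime (X : Execution G F f ζ α) (i : V) (k : ℕ) : ℝ :=
  X.fireTime i k - ((X.state (X.nextUpdate i k + 1) i).phase - 1 / 2) / (X.state k i).freq

/-- The outcome of a round of the normal node `i`. -/
structure IsRoundEnd (X : Execution G F f ζ α) (k : V → ℕ) (i : V) : Prop where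
  flag : (X.state (X.nextUpdate i (k i) + 1) i).flag = false
  started : (X.state (X.nextUpdate i (k i) + 1) i).started = false
  starts : (X.state (X.nextUpdate i (k i) + 1) i).starts = ∅
  ends : (X.state (X.nextUpdate i (k i) + 1) i).ends = ∅
  idle : inDeg G i ≤ f → (X.state (X.nextUpdate i (k i) + 1) i).zUp = 0 ∧
    (X.state (X.nextUpdate i (k i) + 1) i).zDown = 0
  freq : AttractsAt G F f α (fun j => (X.state (k j) j).freq) i
    (X.state (X.nextUpdate i (k i) + 1) i).freq
  freq' : AttractsAt G F f α (-fun j => (X.state (k j) j).freq) i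
    (-(X.state (X.nextUpdate i (k i) + 1) i).freq)
  aim : AttractsAt G F f (1 / 2) (fun j => X.fireTime j (k j)) i (X.aimTime i (k i))
  aim' : AttractsAt G F f (1 / 2) (-fun j => X.fireTime j (k j)) i (-X.aimTime i (k i))

theorem cwDist_of_le {x y : ℝ} (h : y ≤ x) : cwDist x y = x - y := if_pos h

theorem cwDist_of_lt {x y : ℝ} (h : x < y) : cwDist x y = 1 - y + x := if_neg (not_le.2 h)

section

variable {X : Execution G F f ζ α} {δ D : ℝ} {k : V → ℕ}

namespace IsRoundStart

variable (hk : X.IsRoundStart δ k)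

include hk

theorem isRound (hζ : 0 < ζ) (hζ' : ζ < 1 / 2) {i : V} (hi : i ∉ F) : X.IsRound i (k i) :=
  X.isRound hi hζ hζ' (by linarith [hk.one_le_freq i hi]) (hk.phase_le i hi) (hk.flag i hi)
    (hk.started i hi)

/-- The update of `i` comes at least `(1 - δ) / 2` after its firing, while firings are at most `D`
apart. -/
theorem fire_lt_update (hζ : 0 < ζ) (hζ' : ζ < 1 / 2) (hδ : 0 ≤ δ) (hD : D + δ < 1 / 2 - ζ)
    (hspread : ∀ i j, i ∉ F → j ∉ F → X.fireTime i (k i) - X.fireTime j (k j) ≤ D)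
    {i j : V} (hi : i ∉ F) (hj : j ∉ F) : X.nextFire j (k j) < X.nextUpdate i (k i) := by
  have ri := hk.isRound hζ hζ' hi
  have rj := hk.isRound hζ hζ' hj
  have h1 := hk.one_le_freq i hi
  have h2 := hk.freq_le i hi
  have h3 := hspread j i hj hi
  refine Nat.lt_of_succ_lt_succ (X.lt_of_time_lt ?_)
  rw [Nat.succ_eq_add_one, Nat.succ_eq_add_one, rj.time_fire, ri.time_update]
  have h4 : (1 - δ) / 2 ≤ 1 / (2 * (X.state (k i) i).freq) := by
    rw [div_le_div_iff₀ (by norm_num) (by linarith)]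
    nlinarith
  linarith

/-- During the round of `i`, a normal node emits exactly one start and one end pulse. -/
theorem pulse_unique (hζ : 0 < ζ) (hζ' : ζ < 1 / 2)
    {i j : V} (hi : i ∉ F) (hj : j ∉ F)
    (hsil : ∀ l, X.nextUpdate j (k j) < l → l < X.nextUpdate i (k i) →
      X.event l ≠ .start j ∧ X.event l ≠ .fire j) {l : ℕ} (hl : k i ≤ l)
    (hl' : l < X.nextUpdate i (k i)) :
    (X.event l = .start j → l = X.nextStart j (k j)) ∧
    (X.event l = .fire j → l = X.nextFire j (k j)) := by
  have rj := hk.isRound hζ hζ' hj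
  rcases lt_or_ge l (k j) with h1 | h1
  · have := hk.silent i j hi hj l hl h1
    exact ⟨fun h => absurd h this.1, fun h => absurd h this.2⟩
  rcases lt_or_ge (X.nextUpdate j (k j)) l with h2 | h2
  · have := hsil l h2 hl'
    exact ⟨fun h => absurd h this.1, fun h => absurd h this.2⟩
  constructor
  · intro h
    rcases rj.own l h1 h2 (Or.inl h) with e | e | e
    · exact e
    · have := rj.event_fire
      rw [← e, h] at this
      exact absurd this (by simp)
    · have := rj.event_update
      rw [← e, h] at this
      exact absurd this (by simp)
  · intro h
    rcases rj.own l h1 h2 (Or.inr (Or.inl h)) with e | e | e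
    · have := rj.event_start
      rw [← e, h] at this
      exact absurd this (by simp)
    · exact e
    · have := rj.event_update
      rw [← e, h] at this
      exact absurd this (by simp)

omit hk in
theorem _root_.PulseSync.Execution.IsRound.phaseBefore_le {i : V} {m l : ℕ} (r : X.IsRound i m)
    (hl : m ≤ l) (hl' : l ≤ X.nextFire i m) :
    X.phaseBefore i l = 1 - (X.state m i).freq * (X.fireTime i m - X.time (l + 1)) := by
  have := r.fire_lt
  rw [phaseBefore_eq, r.phase_before_fire l hl hl', r.freq_eq l hl (by omega)]
  ring

omit hk in
theorem _root_.PulseSync.Execution.IsRound.phaseBefore_gt {i : V} {m l : ℕ} (r : X.IsRound i m)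
    (hl : X.nextFire i m < l) (hl' : l ≤ X.nextUpdate i m) :
    X.phaseBefore i l = (X.state m i).freq * (X.time (l + 1) - X.fireTime i m) := by
  have := r.le_start
  have := r.start_lt
  rw [phaseBefore_eq, r.phase_after_fire l hl hl', r.freq_eq l (by omega) hl']
  ring

/-- The relative frequency of a normal in-neighbour is measured correctly. -/
theorem cwDist_eq (hζ : 0 < ζ) (hζ' : ζ < 1 / 2) (hδ : δ < 1) {i j : V} (hi : i ∉ F) (hj : j ∉ F)
    (hlt : X.nextFire j (k j) < X.nextUpdate i (k i)) :
    cwDist (X.phaseBefore i (X.nextFire j (k j))) (X.phaseBefore i (X.nextStart j (k j))) =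
      (X.state (k i) i).freq * (ζ / (X.state (k j) j).freq) := by
  have ri := hk.isRound hζ hζ' hi
  have rj := hk.isRound hζ hζ' hj
  have h1 := hk.one_le_freq i hi
  have h2 := hk.freq_le i hi
  have h3 := hk.one_le_freq j hj
  have hS := hk.le_start i j hi hj
  have hSF := rj.start_lt
  have hpos : 0 < (X.state (k i) i).freq * (ζ / (X.state (k j) j).freq) := by
    have : 0 < (X.state (k i) i).freq := by linarith
    have : 0 < (X.state (k j) j).freq := by linarith
    positivity
  -- Between the two pulses the receiver advances by less than one turn, so the clockwise distance
  -- loses no full turn.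
  have hlt1 : (X.state (k i) i).freq * (ζ / (X.state (k j) j).freq) < 1 := by
    rw [mul_div_assoc', div_lt_one (by linarith)]
    nlinarith
  -- The own firing may follow both pulses, precede both, or fall between them; only in the last
  -- case does the phase wrap around.
  rcases le_or_gt (X.nextFire j (k j)) (X.nextFire i (k i)) with hF | hF
  · rw [ri.phaseBefore_le (by omega) hF, ri.phaseBefore_le hS (by omega), rj.time_fire,
      rj.time_start, cwDist_of_le (by nlinarith)]
    ring
  rcases lt_or_ge (X.nextFire i (k i)) (X.nextStart j (k j)) with hS' | hS'
  · rw [ri.phaseBefore_gt hF (by omega), ri.phaseBefore_gt hS' (by omega), rj.time_fire,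
      rj.time_start, cwDist_of_le (by nlinarith)]
    ring
  · rw [ri.phaseBefore_gt hF (by omega), ri.phaseBefore_le hS hS', rj.time_fire,
      rj.time_start, cwDist_of_lt (by nlinarith)]
    ring

end IsRoundStart

/-- The values of `z̄_i` and `z̲_i` in terms of the reception times. -/
theorem IsRound.latched_value {i : V} {m b : ℕ} (r : X.IsRound i m)
    (hω : 0 < (X.state m i).freq) (hb : m ≤ b) (hb' : b ≤ X.nextUpdate i m)
    (h1 : (X.state m i).freq * (X.fireTime i m - X.time (b + 1)) < 1 / 2)
    (h2 : (X.state m i).freq * (X.time (b + 1) - X.fireTime i m) < 1 / 2) :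
    (if 1 / 2 ≤ X.phaseBefore i b ∧ X.phaseBefore i b < 1 then 1 - X.phaseBefore i b else 0) =
      (X.state m i).freq * (X.fireTime i m - min (X.fireTime i m) (X.time (b + 1))) ∧
    (if 0 ≤ X.phaseBefore i b ∧ X.phaseBefore i b < 1 / 2 then -X.phaseBefore i b else 0) =
      (X.state m i).freq * (X.fireTime i m - max (X.fireTime i m) (X.time (b + 1))) := by
  rcases le_or_gt b (X.nextFire i m) with h | h
  · have hle : X.time (b + 1) ≤ X.fireTime i m := by
      rw [← r.time_fire]
      exact X.time_mono (by omega)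
    have h0 : 0 ≤ (X.state m i).freq * (X.fireTime i m - X.time (b + 1)) :=
      mul_nonneg hω.le (by linarith)
    rw [r.phaseBefore_le hb h, min_eq_right hle, max_eq_left hle]
    constructor
    -- The else branch can only mean phase `1`: the pulse arrives at the very instant of the own
    -- firing, and both sides vanish.
    · split_ifs with hc
      · ring
      · rw [not_and_or, not_le, not_lt] at hc
        rcases hc with hc | hc <;> linarith
    · rw [if_neg (fun hc => by linarith [hc.2])]
      ring
  · have hle : X.fireTime i m ≤ X.time (b + 1) := by
      rw [← r.time_fire]
      exact X.time_mono (by omega)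
    have h0 : 0 ≤ (X.state m i).freq * (X.time (b + 1) - X.fireTime i m) :=
      mul_nonneg hω.le (by linarith)
    rw [r.phaseBefore_gt h hb', min_eq_left hle, max_eq_right hle]
    constructor
    · rw [if_neg (fun hc => by linarith [hc.1])]
      ring
    · rw [if_pos ⟨h0, h2⟩]
      ring

/-- The outcome of the round of `i`, provided that the other nodes do not start their next round too
early. -/
theorem IsRoundStart.isRoundEnd (hk : X.IsRoundStart δ k) (hζ : 0 < ζ) (hζ' : ζ < 1 / 2)
    (hα : 0 < α) (hlocal : IsLocalAttack G F f) (hrobust : IsRobust G (2 * f + 1))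
    (hund : X.Undetected) (hδ : 0 ≤ δ) (hD : D + δ < 1 / 2 - ζ)
    (hspread : ∀ i j, i ∉ F → j ∉ F → X.fireTime i (k i) - X.fireTime j (k j) ≤ D)
    {i : V} (hi : i ∉ F)
    (hsil : ∀ j, j ∉ F → ∀ l, X.nextUpdate j (k j) < l → l < X.nextUpdate i (k i) →
      X.event l ≠ .start j ∧ X.event l ≠ .fire j) : X.IsRoundEnd k i := by
  classical
  have ri := hk.isRound hζ hζ' hi
  set U := X.nextUpdate i (k i) with hU
  set ω := (X.state (k i) i).freq with hω
  have hD0 : 0 ≤ D := by simpa using hspread i i hi hi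
  have h1 : 1 ≤ ω := hk.one_le_freq i hi
  have h2 : ω ≤ 1 + δ := hk.freq_le i hi
  have hωD : ω * D < 1 / 2 := by nlinarith
  have hkU : k i ≤ U := by
    have := ri.le_start; have := ri.start_lt; have := ri.fire_lt; omega
  have noUpd : ∀ l, k i ≤ l → l < U → X.event l ≠ .update i := by
    intro l hl hl' he
    rcases ri.own l hl hl'.le (Or.inr (Or.inr he)) with e | e | e
    · have := ri.event_start
      rw [← e, he] at this
      exact absurd this (by simp)
    · have := ri.event_fire
      rw [← e, he] at this
      exact absurd this (by simp)
    · omega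
  have hends : ∀ l, k i ≤ l → l ≤ U → (X.state l i).ends = X.pulses i (k i) l := fun l hl hl' =>
    X.ends_eq_pulses hi hl (hk.ends i hi) fun m hm hm' => noUpd m hm (by omega)
  set E := X.pulses i (k i) U with hE
  have hfU : ∀ j, j ∉ F → X.nextFire j (k j) < U := fun j hj =>
    hk.fire_lt_update hζ hζ' hδ hD hspread hi hj
  have huniq : ∀ j, j ∉ F → ∀ l, k i ≤ l → l < U →
      (X.event l = .start j → l = X.nextStart j (k j)) ∧
      (X.event l = .fire j → l = X.nextFire j (k j)) := fun j hj l hl hl' =>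
    hk.pulse_unique hζ hζ' hi hj (hsil j hj) hl hl'
  have hSF : ∀ j, j ∉ F → k i ≤ X.nextStart j (k j) ∧ X.nextStart j (k j) < X.nextFire j (k j) :=
    fun j hj => ⟨hk.le_start i j hi hj, (hk.isRound hζ hζ' hj).start_lt⟩
  have evF : ∀ j, j ∉ F → X.event (X.nextFire j (k j)) = .fire j := fun j hj =>
    (hk.isRound hζ hζ' hj).event_fire
  have evS : ∀ j, j ∉ F → X.event (X.nextStart j (k j)) = .start j := fun j hj =>
    (hk.isRound hζ hζ' hj).event_start
  have hnbr : ∀ j, j ∈ inNbrs G i \ F ↔ G.Adj i j ∧ j ∉ F := fun j => by simp [inNbrs]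
  have hcount : (X.state U i).count = E.card := by rw [Osc.count, hends U hkU le_rfl]
  have hrec : IsReception G F f i E (fun j => X.nextFire j (k j)) := by
    refine isReception hlocal hi (fun j hj => ?_) (fun j hj j' hj' h => ?_) (fun l hl => ?_)
      (fun h => ?_)
    · obtain ⟨hadj, hj⟩ := (hnbr j).1 hj
      have := hSF j hj
      exact X.mem_pulses.2 ⟨by omega, hfU j hj, j, hadj, evF j hj⟩
    · have e1 := evF j ((hnbr j).1 hj).2
      have e2 := evF j' ((hnbr j').1 hj').2
      rw [h, e2] at e1
      injection e1 with e1
      exact e1.symm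
    · obtain ⟨hl, hl', j, hadj, he⟩ := X.mem_pulses.1 hl
      exact ⟨j, hadj, fun hj => (huniq j hj l hl hl').2 he⟩
    · by_contra! hlt
      exact hund U i ⟨hi, ri.event_update, by rwa [hcount]⟩ h
  have hdich := hrobust.inDeg_dichotomy i
  have hstep := X.step U i hi
  have hev : X.event U = .update i := ri.event_update
  simp only [LocalStep, hev, if_true] at hstep
  have hcount' : ((X.state U i).flow (X.time (U + 1) - X.time U)).count = E.card := hcount
  have hends' : ((X.state U i).flow (X.time (U + 1) - X.time U)).ends = E := hends U hkU le_rfl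
  have hphase : ((X.state U i).flow (X.time (U + 1) - X.time U)).phase = 1 / 2 :=
    (X.update_ok U i ri.event_update).2.1
  rcases hstep with ⟨hlt, -⟩ | ⟨-, v, w, a, J, hv, hT, ha, hw, hsum, hs⟩
  · rw [hcount'] at hlt
    exact absurd hrec.card_le (not_le.2 hlt)
  rw [hcount', hends'] at hT
  -- Both filters are singletons by uniqueness of the pulses, so `v` is the measured ratio of the
  -- two frequencies.
  have hval : ∀ j ∈ inNbrs G i \ F, v (X.nextFire j (k j)) * ω = (X.state (k j) j).freq := by
    intro j hj
    obtain ⟨hadj, hj⟩ := (hnbr j).1 hj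
    have hb := hSF j hj
    have hb' := hfU j hj
    have := hv j (X.nextStart j (k j)) (X.nextFire j (k j)) ?_ ?_
    · rw [this]
      have e := hk.cwDist_eq hζ hζ' (by linarith) hi hj hb'
      simp only [phaseBefore] at e
      rw [e]
      have := hk.one_le_freq j hj
      have h3 : (X.state (k j) j).freq ≠ 0 := by linarith
      have h4 : ω ≠ 0 := by linarith
      rw [← hω]
      field_simp
    · ext l
      rw [Finset.mem_filter, Finset.mem_singleton]
      change l ∈ (X.state U i).starts ∧ _ ↔ _
      rw [X.mem_starts hi hkU (hk.starts i hi) noUpd]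
      constructor
      · rintro ⟨⟨hl, hl', -⟩, he⟩
        exact (huniq j hj l hl hl').1 he
      · rintro rfl
        exact ⟨⟨hb.1, by omega, j, hadj, evS j hj⟩, evS j hj⟩
    · ext l
      rw [hends', Finset.mem_filter, Finset.mem_singleton]
      constructor
      · rintro ⟨hl, he⟩
        obtain ⟨hl, hl', -⟩ := X.mem_pulses.1 hl
        exact (huniq j hj l hl hl').2 he
      · rintro rfl
        exact ⟨hrec.mem j ((hnbr j).2 ⟨hadj, hj⟩), evF j hj⟩
  have hfreq : (X.state (U + 1) i).freq = a * ω + ∑ l ∈ J, w l * (v l * ω) := by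
    rw [hs]
    change (a + ∑ l ∈ J, w l * v l) * (X.state U i).freq = _
    rw [ri.freq_eq U hkU le_rfl, add_mul, Finset.sum_mul]
    simp only [mul_assoc, hω]
  have hphase' : (X.state (U + 1) i).phase =
      1 / 2 + ((X.state U i).zUp + (X.state U i).zDown) / 2 := by
    rw [hs, ← hphase]; rfl
  have hzUp : (X.state (U + 1) i).zUp = (X.state U i).zUp := by rw [hs]; rfl
  have hzDown : (X.state (U + 1) i).zDown = (X.state U i).zDown := by rw [hs]; rfl
  obtain ⟨up1, up2⟩ := X.latched (i := i) hkU (fun l => (X.state l i).zUp) (fun l =>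
    if 1 / 2 ≤ X.phaseBefore i l ∧ X.phaseBefore i l < 1 then 1 - X.phaseBefore i l else 0) (f + 1)
    (fun l hl hl' => by
      rw [X.step_zUp hi (noUpd l hl hl'), hends l hl hl'.le])
  obtain ⟨dn1, dn2⟩ := X.latched (i := i) hkU (fun l => (X.state l i).zDown) (fun l =>
    if 0 ≤ X.phaseBefore i l ∧ X.phaseBefore i l < 1 / 2 then -X.phaseBefore i l else 0)
    (inDeg G i - f)
    (fun l hl hl' => by
      rw [X.step_zDown hi (noUpd l hl hl'), hends l hl hl'.le])
  rw [← hE] at up1 up2 dn1 dn2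
  -- The reset does not clear these variables. If `d ≤ f`, the count never reaches `f + 1`, and `d -
  -- f` is truncated to `0`, which a count plus one never equals; so the zeros persist. If `d ≥ 2f +
  -- 1`, both are overwritten in each round.
  have hidle : inDeg G i ≤ f → (X.state U i).zUp = 0 ∧ (X.state U i).zDown = 0 := by
    intro hd
    have := hrec.card_le
    have h0 := hk.idle i hi hd
    exact ⟨(up1 (Or.inl (by omega))).trans h0.1, (dn1 (Or.inr (by omega))).trans h0.2⟩
  have haim : X.aimTime i (k i) = X.fireTime i (k i) -
      ((X.state U i).zUp + (X.state U i).zDown) / 2 / ω := by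
    rw [aimTime, ← hU, hphase', ← hω]; ring
  have haims : AttractsAt G F f (1 / 2) (fun j => X.fireTime j (k j)) i (X.aimTime i (k i)) ∧
      AttractsAt G F f (1 / 2) (-fun j => X.fireTime j (k j)) i (-X.aimTime i (k i)) := by
    rcases hdich with hd | hd
    · obtain ⟨z1, z2⟩ := hidle hd
      rw [haim, z1, z2, add_zero, zero_div, zero_div, sub_zero]
      have hcard : ∀ P : V → Prop, ¬ f + 1 ≤ ((inNbrs G i \ F).filter P).card := by
        intro P hP
        have := hP.trans (Finset.card_le_card
          ((Finset.filter_subset _ _).trans Finset.sdiff_subset))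
        simp only [inDeg] at hd
        omega
      constructor
      · intro M ε hε hM hlow
        rcases hlow with hlow | hlow
        · simp only at hlow; linarith
        · exact absurd hlow (hcard _)
      · intro M ε hε hM hlow
        rcases hlow with hlow | hlow
        · simp only [Pi.neg_apply] at hlow; linarith
        · exact absurd hlow (hcard _)
    · have hcN := hrec.card_normal
      have hcE := hrec.card_normal_le
      obtain ⟨b₁, hb₁, hc₁, hz₁⟩ := up2 (by omega) (by omega)
      obtain ⟨b₂, hb₂, hc₂, hz₂⟩ := dn2 (by omega) (by omega)
      have hpul : ∀ b ∈ E, X.pulses i (k i) b = E.filter (· < b) := by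
        intro b hb
        have := (X.mem_pulses.1 hb).2.1
        ext l
        rw [Finset.mem_filter, X.mem_pulses, X.mem_pulses]
        constructor
        · rintro ⟨h1, h2, h3⟩
          exact ⟨⟨h1, by omega, h3⟩, h2⟩
        · rintro ⟨⟨h1, h2, h3⟩, h4⟩
          exact ⟨h1, h4, h3⟩
      rw [hpul _ hb₁] at hc₁
      rw [hpul _ hb₂] at hc₂
      have hT' : Monotone fun l => X.time (l + 1) := fun l l' h => X.time_mono (by omega)
      have hx : ∀ j, j ∉ F → X.fireTime j (k j) = X.time (X.nextFire j (k j) + 1) := fun j hj =>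
        (hk.isRound hζ hζ' hj).time_fire.symm
      -- A latching pulse lies between the firings of two normal nodes, hence within `D` of the own
      -- firing. So the half-circle tests take the intended branch.
      have hnear : ∀ b ∈ E, f ≤ (E.filter (· < b)).card →
          (E.filter (· < b)).card < (inNbrs G i \ F).card →
          ω * (X.fireTime i (k i) - X.time (b + 1)) < 1 / 2 ∧
          ω * (X.time (b + 1) - X.fireTime i (k i)) < 1 / 2 := by
        intro b hb hc hc'
        obtain ⟨j, hj, hle⟩ := hrec.exists_le hb hc
        obtain ⟨j', hj', -, hle'⟩ := hrec.le_of_card (b := b) (P := fun _ => True)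
          (by rwa [Finset.filter_true])
        have e : X.fireTime j (k j) ≤ X.time (b + 1) := (hx j ((hnbr j).1 hj).2).le.trans (hT' hle)
        have e' : X.time (b + 1) ≤ X.fireTime j' (k j') :=
          (hT' hle').trans (hx j' ((hnbr j').1 hj').2).symm.le
        have s := hspread i j hi ((hnbr j).1 hj).2
        have s' := hspread j' i ((hnbr j').1 hj').2 hi
        constructor
        · refine lt_of_le_of_lt (mul_le_mul_of_nonneg_left ?_ (by linarith)) hωD
          linarith
        · refine lt_of_le_of_lt (mul_le_mul_of_nonneg_left ?_ (by linarith)) hωD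
          linarith
      have mE : ∀ b ∈ E, k i ≤ b ∧ b ≤ U := fun b hb =>
        ⟨(X.mem_pulses.1 hb).1, (X.mem_pulses.1 hb).2.1.le⟩
      have n₁ := hnear b₁ hb₁ (by omega) (by omega)
      have n₂ := hnear b₂ hb₂ (by omega) (by omega)
      have l₁ := (ri.latched_value (by linarith) (mE b₁ hb₁).1 (mE b₁ hb₁).2 n₁.1 n₁.2).1
      have l₂ := (ri.latched_value (by linarith) (mE b₂ hb₂).1 (mE b₂ hb₂).2 n₂.1 n₂.2).2
      have hy : X.aimTime i (k i) = (min (X.fireTime i (k i)) (X.time (b₁ + 1)) +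
          max (X.fireTime i (k i)) (X.time (b₂ + 1))) / 2 := by
        rw [haim, hz₁, hz₂, l₁, l₂, ← hω]
        field_simp
        ring
      rw [hy]
      exact hrec.attractsAt_mid hi hT' hb₁ hb₂ hc₁ hc₂ hx
  have hgood : AttractsAt G F f α (fun j => (X.state (k j) j).freq) i (X.state (U + 1) i).freq := by
    rw [hfreq]
    exact hrec.attractsAt_avg hi hdich (v := fun l => v l * ω) hval (hT.mul_right (by linarith))
      hα.le ha hw hsum
  have hgood' : AttractsAt G F f α (-fun j => (X.state (k j) j).freq) i
      (-(X.state (U + 1) i).freq) := by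
    have := hrec.attractsAt_avg hi hdich (v := fun l => -(v l * ω))
      (x := -fun j => (X.state (k j) j).freq) (fun j hj => by simp only [hval j hj, Pi.neg_apply])
      (hT.mul_right (by linarith)).neg hα.le ha hw hsum
    convert this using 1
    rw [hfreq]
    simp only [Pi.neg_apply, mul_neg, Finset.sum_neg_distrib, ← hω]
    ring
  refine ⟨?_, ?_, ?_, ?_, fun hd => ?_, hgood, hgood', haims.1, haims.2⟩
  · rw [hs]; rfl
  · rw [hs]; exact ri.started_false
  · rw [hs]; rfl
  · rw [hs]; rfl
  · rw [← hU, hzUp, hzDown]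
    exact hidle hd

end

end Execution
end PulseSync

namespace PulseSync

/-! ### Spreads -/

section Spread

variable {V : Type*} {F : Finset V}

/-- The maximal difference of two values at normal nodes. -/
noncomputable def spread (F : Finset V) (x : V → ℝ) : ℝ :=
  ⨆ p : {i // i ∉ F} × {i // i ∉ F}, |x p.1 - x p.2|

theorem abs_sub_le_spread [Finite V] (x : V → ℝ) {i j : V} (hi : i ∉ F) (hj : j ∉ F) :
    |x i - x j| ≤ spread F x :=
  le_ciSup (f := fun p : {i // i ∉ F} × {i // i ∉ F} => |x p.1 - x p.2|)
    (Set.finite_range _).bddAbove (⟨i, hi⟩, ⟨j, hj⟩)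

theorem sub_le_spread [Finite V] (x : V → ℝ) {i j : V} (hi : i ∉ F) (hj : j ∉ F) :
    x i - x j ≤ spread F x :=
  (le_abs_self _).trans (abs_sub_le_spread x hi hj)

theorem spread_nonneg (x : V → ℝ) : 0 ≤ spread F x :=
  Real.iSup_nonneg fun _ => abs_nonneg _

theorem spread_le {x : V → ℝ} {c : ℝ} {i₀ : V} (h₀ : i₀ ∉ F)
    (h : ∀ i j, i ∉ F → j ∉ F → x i - x j ≤ c) : spread F x ≤ c := by
  have : Nonempty {i // i ∉ F} := ⟨⟨i₀, h₀⟩⟩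
  exact ciSup_le fun p => abs_sub_le_iff.2 ⟨h _ _ p.1.2 p.2.2, h _ _ p.2.2 p.1.2⟩

theorem exists_hull [Finite V] (x : V → ℝ) {i₀ : V} (h₀ : i₀ ∉ F) :
    ∃ m M : ℝ, (∀ i, i ∉ F → m ≤ x i ∧ x i ≤ M) ∧ (∃ i, i ∉ F ∧ x i = m) ∧
      (∃ i, i ∉ F ∧ x i = M) ∧ M - m ≤ spread F x := by
  have : Nonempty {i // i ∉ F} := ⟨⟨i₀, h₀⟩⟩
  obtain ⟨a, ha⟩ := Finite.exists_min fun i : {i // i ∉ F} => x i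
  obtain ⟨b, hb⟩ := Finite.exists_max fun i : {i // i ∉ F} => x i
  exact ⟨x a, x b, fun i hi => ⟨ha ⟨i, hi⟩, hb ⟨i, hi⟩⟩, ⟨a, a.2, rfl⟩, ⟨b, b.2, rfl⟩,
    sub_le_spread x b.2 a.2⟩

end Spread

/-! ### Arcs -/

/-- If `φ i - φ j` exceeded the length `l` of a containing arc, the floors of `φ i - a` and `φ j -
a` would differ by an integer strictly between `0` and `1`, all phases being in a half circle. -/
theorem sub_le_arcLength {V : Type*} {F : Finset V} {φ : V → ℝ}
    (hφ : ∀ i, i ∉ F → φ i ∈ Set.Ico 0 (1 / 2)) {i j : V} (hi : i ∉ F) (hj : j ∉ F) :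
    φ i - φ j ≤ arcLength F φ := by
  refine le_csInf ⟨1, zero_le_one, 0, fun i _ => (Int.fract_lt_one _).le⟩ ?_
  rintro l ⟨hl, a, ha⟩
  obtain ⟨i0, i1⟩ := hφ i hi
  obtain ⟨j0, j1⟩ := hφ j hj
  by_contra! hlt
  have hi' := ha i hi
  have hj' := ha j hj
  have h1 := Int.fract_nonneg (φ i - a)
  have h2 := Int.fract_nonneg (φ j - a)
  have h3 := Int.self_sub_floor (φ i - a)
  have h4 := Int.self_sub_floor (φ j - a)
  have h5 : ((⌊φ i - a⌋ - ⌊φ j - a⌋ : ℤ) : ℝ) =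
      (φ i - φ j) - (Int.fract (φ i - a) - Int.fract (φ j - a)) := by
    push_cast; linarith
  have h6 : ⌊φ i - a⌋ - ⌊φ j - a⌋ < 1 := by
    have : ((⌊φ i - a⌋ - ⌊φ j - a⌋ : ℤ) : ℝ) < (1 : ℤ) := by
      rw [h5]; push_cast; linarith
    exact_mod_cast this
  have h7 : 0 < ⌊φ i - a⌋ - ⌊φ j - a⌋ := by
    have : ((0 : ℤ) : ℝ) < ((⌊φ i - a⌋ - ⌊φ j - a⌋ : ℤ) : ℝ) := by
      rw [h5]; push_cast; linarith
    exact_mod_cast this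
  omega

theorem arcLength_lt {V : Type*} [Finite V] {F : Finset V} {φ θ : V → ℝ} {c : ℝ} (hc : 0 < c)
    (hc1 : c ≤ 1) (hlift : ∀ i, i ∉ F → ∃ z : ℤ, φ i = θ i + z)
    (hθ : ∀ i j, i ∉ F → j ∉ F → θ i - θ j < c) : arcLength F φ < c := by
  by_cases hne : ∃ i, i ∉ F
  · obtain ⟨i₀, h₀⟩ := hne
    obtain ⟨m, M, hmM, ⟨a, ha, rfl⟩, ⟨b, hb, rfl⟩, -⟩ := exists_hull θ h₀
    refine lt_of_le_of_lt (csInf_le ⟨0, fun l hl => hl.1⟩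
      ⟨sub_nonneg.2 (hmM a ha).2, θ a, fun i hi => ?_⟩) (hθ b a hb ha)
    obtain ⟨z, hz⟩ := hlift i hi
    have h1 := hmM i hi
    have h2 := hθ i a hi ha
    rw [hz, show θ i + z - θ a = θ i - θ a + z by ring, Int.fract_add_intCast,
      Int.fract_eq_self.2 ⟨by linarith, by linarith⟩]
    linarith
  · push Not at hne
    refine lt_of_le_of_lt (csInf_le ⟨0, fun l hl => hl.1⟩
      ⟨le_rfl, 0, fun i hi => absurd (hne i) hi⟩) hc

theorem dist_unitAddCircle_le {x y a b : ℝ} (hx : ∃ z : ℤ, x = a + z) (hy : ∃ z : ℤ, y = b + z) :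
    dist (x : UnitAddCircle) (y : UnitAddCircle) ≤ |a - b| := by
  obtain ⟨z, rfl⟩ := hx
  obtain ⟨w, rfl⟩ := hy
  rw [dist_eq_norm, ← AddCircle.coe_sub, UnitAddCircle.norm_eq]
  refine (round_le _ (z - w)).trans (le_of_eq ?_)
  push_cast
  congr 1; ring

namespace Execution

variable {V : Type*} [Fintype V] {G : Digraph V} {F : Finset V} {f : ℕ} {ζ α : ℝ}

section

variable {X : Execution G F f ζ α} {δ D : ℝ} {k : V → ℕ}

/-! ### From one round to the next -/

theorem IsRoundEnd.aim_sub_le {j : V} (he : X.IsRoundEnd k j) (hj : j ∉ F)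
    (hspread : ∀ i j, i ∉ F → j ∉ F → X.fireTime i (k i) - X.fireTime j (k j) ≤ D)
    {i : V} (hi : i ∉ F) : |X.aimTime j (k j) - X.fireTime i (k i)| ≤ D := by
  rw [abs_sub_le_iff]
  constructor
  · have := he.aim.le hj (M := X.fireTime i (k i) + D) fun l hl => by linarith [hspread l i hl hi]
    linarith
  · have := he.aim'.ge hj (m := X.fireTime i (k i) - D) fun l hl => by linarith [hspread i l hi hl]
    linarith

section

variable (hk : X.IsRoundStart δ k)

include hk

theorem IsRoundStart.freq_next {j : V} (he : X.IsRoundEnd k j) (hj : j ∉ F) :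
    1 ≤ (X.state (X.nextUpdate j (k j) + 1) j).freq ∧
    (X.state (X.nextUpdate j (k j) + 1) j).freq ≤ 1 + δ :=
  ⟨he.freq'.ge hj hk.one_le_freq, he.freq.le hj hk.freq_le⟩

/-- The jump is the frequency times the distance from aim to firing time, at most `(1 + δ) * D ≤ D +
δ`. -/
theorem IsRoundStart.phase_next (hδ : 0 ≤ δ) (hD : D + δ < 1 / 2)
    (hspread : ∀ i j, i ∉ F → j ∉ F → X.fireTime i (k i) - X.fireTime j (k j) ≤ D)
    {j : V} (he : X.IsRoundEnd k j) (hj : j ∉ F) :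
    |(X.state (X.nextUpdate j (k j) + 1) j).phase - 1 / 2| ≤ D + δ := by
  have h0 : 0 ≤ D := by simpa using hspread j j hj hj
  have h1 := hk.one_le_freq j hj
  have h2 := hk.freq_le j hj
  have h3 := he.aim_sub_le hj hspread hj
  rw [aimTime, sub_sub_cancel_left, abs_neg, abs_div, abs_of_nonneg (by linarith : 0 ≤
    (X.state (k j) j).freq), div_le_iff₀ (by linarith)] at h3
  nlinarith

/-- The phase `p` after the jump is the one that a firing at the aim would have produced. From the
aim on, the node thus covers `p` at the old frequency and `1 - p` at the new one. -/
theorem IsRoundStart.fireTime_next (hζ : 0 < ζ) (hζ' : ζ < 1 / 2) {j : V} (hj : j ∉ F) :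
    X.fireTime j (X.nextUpdate j (k j) + 1) = X.aimTime j (k j) +
      (X.state (X.nextUpdate j (k j) + 1) j).phase / (X.state (k j) j).freq +
      (1 - (X.state (X.nextUpdate j (k j) + 1) j).phase) /
        (X.state (X.nextUpdate j (k j) + 1) j).freq := by
  have h1 := hk.one_le_freq j hj
  have h4 : (X.state (k j) j).freq ≠ 0 := by linarith
  rw [fireTime, aimTime, (hk.isRound hζ hζ' hj).time_update]
  congr 1
  field_simp
  ring

/-- The next start pulses come after all updates of the current round. -/
theorem IsRoundStart.update_lt_start (hζ : 0 < ζ) (hζ' : ζ < 1 / 2) (hδ : 0 ≤ δ)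
    (hD : D + δ < 1 / 2 - ζ)
    (hspread : ∀ i j, i ∉ F → j ∉ F → X.fireTime i (k i) - X.fireTime j (k j) ≤ D)
    {i j : V} (hi : i ∉ F) (hj : j ∉ F) (he : X.IsRoundEnd k j) :
    X.IsRound j (X.nextUpdate j (k j) + 1) ∧
    X.nextUpdate i (k i) < X.nextStart j (X.nextUpdate j (k j) + 1) := by
  obtain ⟨f1, f2⟩ := hk.freq_next he hj
  obtain ⟨p1, p2⟩ := abs_le.1 (hk.phase_next hδ (by linarith) hspread he hj)
  have h1 := hk.one_le_freq j hj
  have h2 := hk.freq_le j hj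
  have h3 := hk.one_le_freq i hi
  have r := X.isRound hj hζ hζ' (k₀ := X.nextUpdate j (k j) + 1) (by linarith) (by linarith)
    he.flag he.started
  refine ⟨r, Nat.lt_of_succ_lt_succ (X.lt_of_time_lt ?_)⟩
  rw [Nat.succ_eq_add_one, Nat.succ_eq_add_one, r.time_start,
    (hk.isRound hζ hζ' hi).time_update, hk.fireTime_next hζ hζ' hj]
  -- The start pulse of `j` comes at least `(1 - ζ) * (1 - δ)` after its aim, the aim at most `D`
  -- before the firing of `i`, and the update of `i` at most `1 / 2` after that firing; `D + δ < 1 /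
  -- 2 - ζ` decides.
  have a1 := (abs_le.1 (he.aim_sub_le hj hspread hi)).1
  set p := (X.state (X.nextUpdate j (k j) + 1) j).phase
  set ω' := (X.state (X.nextUpdate j (k j) + 1) j).freq
  have b1 : 1 / (2 * (X.state (k i) i).freq) ≤ 1 / 2 :=
    one_div_le_one_div_of_le (by norm_num) (by linarith)
  have b2 : p * (1 - δ) ≤ p / (X.state (k j) j).freq := by
    rw [le_div_iff₀ (by linarith), mul_assoc]
    have : (1 - δ) * (X.state (k j) j).freq ≤ 1 := by nlinarith
    nlinarith
  have b3 : (1 - p - ζ) * (1 - δ) ≤ (1 - p) / ω' - ζ / ω' := by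
    rw [← sub_div, le_div_iff₀ (by linarith), mul_assoc]
    have : (1 - δ) * ω' ≤ 1 := by nlinarith
    nlinarith
  nlinarith

theorem IsRoundStart.silent_after (hζ : 0 < ζ) (hζ' : ζ < 1 / 2) (hδ : 0 ≤ δ)
    (hD : D + δ < 1 / 2 - ζ)
    (hspread : ∀ i j, i ∉ F → j ∉ F → X.fireTime i (k i) - X.fireTime j (k j) ≤ D)
    {i j : V} (hi : i ∉ F) (hj : j ∉ F) (he : X.IsRoundEnd k j) {l : ℕ}
    (hl : X.nextUpdate j (k j) < l) (hl' : l ≤ X.nextUpdate i (k i)) :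
    X.event l ≠ .start j ∧ X.event l ≠ .fire j := by
  obtain ⟨r, hlt⟩ := hk.update_lt_start hζ hζ' hδ hD hspread hi hj he
  have h1 := r.start_lt
  have h2 := r.fire_lt
  have hno : ¬ (X.event l).IsOwn j := by
    intro ho
    rcases r.own l hl (by omega) ho with e | e | e <;> omega
  exact ⟨fun h => hno (Or.inl h), fun h => hno (Or.inr (Or.inl h))⟩

/-- The outcome for `i` needs that nodes already updated stay silent until the update of `i`, which
follows from their own outcome. So the induction runs in the order of the updates. -/
theorem IsRoundStart.all_end (hζ : 0 < ζ) (hζ' : ζ < 1 / 2)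
    (hα : 0 < α) (hlocal : IsLocalAttack G F f) (hrobust : IsRobust G (2 * f + 1))
    (hund : X.Undetected) (hδ : 0 ≤ δ) (hD : D + δ < 1 / 2 - ζ)
    (hspread : ∀ i j, i ∉ F → j ∉ F → X.fireTime i (k i) - X.fireTime j (k j) ≤ D) :
    ∀ i, i ∉ F → X.IsRoundEnd k i := by
  suffices ∀ n i, i ∉ F → X.nextUpdate i (k i) = n → X.IsRoundEnd k i from
    fun i hi => this _ i hi rfl
  intro n
  induction n using Nat.strong_induction_on with
  | _ n ih =>
    rintro i hi rfl
    refine hk.isRoundEnd hζ hζ' hα hlocal hrobust hund hδ hD hspread hi fun j hj l hl hl' => ?_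
    exact hk.silent_after hζ hζ' hδ hD hspread hi hj (ih _ (hl.trans hl') j hj rfl) hl hl'.le

theorem IsRoundStart.next (hζ : 0 < ζ) (hζ' : ζ < 1 / 2) (hδ : 0 ≤ δ) (hD : D + δ < 1 / 2 - ζ)
    (hspread : ∀ i j, i ∉ F → j ∉ F → X.fireTime i (k i) - X.fireTime j (k j) ≤ D)
    (hend : ∀ i, i ∉ F → X.IsRoundEnd k i) :
    X.IsRoundStart δ (fun i => X.nextUpdate i (k i) + 1) where
  flag i hi := (hend i hi).flag
  started i hi := (hend i hi).started
  starts i hi := (hend i hi).starts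
  ends i hi := (hend i hi).ends
  idle i hi := (hend i hi).idle
  phase_nonneg i hi := by
    have := (abs_le.1 (hk.phase_next hδ (by linarith) hspread (hend i hi) hi)).1
    linarith
  phase_le i hi := by
    have := (abs_le.1 (hk.phase_next hδ (by linarith) hspread (hend i hi) hi)).2
    linarith
  one_le_freq i hi := (hk.freq_next (hend i hi) hi).1
  freq_le i hi := (hk.freq_next (hend i hi) hi).2
  le_start i j hi hj := (hk.update_lt_start hζ hζ' hδ hD hspread hi hj (hend j hj)).2
  silent i j hi hj l hl hl' := by
    have rj := hk.isRound hζ hζ' hj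
    have hF := hk.fire_lt_update hζ hζ' hδ hD hspread hi hj
    have h1 := rj.le_start
    have h2 := rj.start_lt
    -- As `i` has already updated, `j` has fired, and only its update is left in the round.
    have hown : (X.event l).IsOwn j → l = X.nextUpdate j (k j) := fun ho => by
      rcases rj.own l (by omega) (by omega) ho with e | e | e <;> omega
    constructor <;> intro h
    · have e := rj.event_update
      rw [← hown (Or.inl h), h] at e
      exact absurd e (by simp)
    · have e := rj.event_update
      rw [← hown (Or.inr (Or.inl h)), h] at e
      exact absurd e (by simp)

/-- The next firing times, up to a common shift and an error bounded by the spread of the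
frequencies. -/
theorem IsRoundStart.fireTime_next_bounds (hζ : 0 < ζ) (hζ' : ζ < 1 / 2) (hδ : 0 ≤ δ)
    (hD : D + δ < 1 / 2)
    (hspread : ∀ i j, i ∉ F → j ∉ F → X.fireTime i (k i) - X.fireTime j (k j) ≤ D)
    {j : V} (hj : j ∉ F) (he : X.IsRoundEnd k j) {m M : ℝ} (hm : 1 ≤ m)
    (hmM : ∀ i, i ∉ F → m ≤ (X.state (k i) i).freq ∧ (X.state (k i) i).freq ≤ M) :
    X.aimTime j (k j) + 1 / M ≤ X.fireTime j (X.nextUpdate j (k j) + 1) ∧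
    X.fireTime j (X.nextUpdate j (k j) + 1) ≤ X.aimTime j (k j) + 1 / M + (M - m) := by
  have f1 := he.freq'.ge hj fun i hi => (hmM i hi).1
  have f2 := he.freq.le hj fun i hi => (hmM i hi).2
  obtain ⟨p1, p2⟩ := abs_le.1 (hk.phase_next hδ hD hspread he hj)
  obtain ⟨g1, g2⟩ := hmM j hj
  rw [hk.fireTime_next hζ hζ' hj]
  set p := (X.state (X.nextUpdate j (k j) + 1) j).phase
  set ω' := (X.state (X.nextUpdate j (k j) + 1) j).freq
  set ω := (X.state (k j) j).freq
  have hp0 : 0 ≤ p := by linarith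
  have hp1 : 0 ≤ 1 - p := by linarith
  -- The time from the aim to the next firing is a convex combination of periods between `1 / M` and
  -- `1 / m`, and these differ by at most `M - m` because `m * M ≥ 1`.
  have e1 : p / M ≤ p / ω := div_le_div_of_nonneg_left hp0 (by linarith) g2
  have e2 : (1 - p) / M ≤ (1 - p) / ω' := div_le_div_of_nonneg_left hp1 (by linarith) f2
  have e3 : p / ω ≤ p / m := div_le_div_of_nonneg_left hp0 (by linarith) g1
  have e4 : (1 - p) / ω' ≤ (1 - p) / m := div_le_div_of_nonneg_left hp1 (by linarith) f1
  have e5 : p / M + (1 - p) / M = 1 / M := by rw [← add_div]; congr 1; ring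
  have e6 : p / m + (1 - p) / m = 1 / m := by rw [← add_div]; congr 1; ring
  have e7 : 1 / m ≤ 1 / M + (M - m) := by
    have hm0 : 0 < m := by linarith
    have hM0 : 0 < M := by linarith
    have : 1 / M + (M - m) - 1 / m = (M - m) * (m * M - 1) / (m * M) := by field_simp; ring
    have h2 : 0 ≤ (M - m) * (m * M - 1) / (m * M) :=
      div_nonneg (mul_nonneg (by linarith) (by nlinarith)) (by positivity)
    linarith
  constructor <;> linarith

end

/-- The start of the first round. -/
theorem isRoundStart_zero (hζ' : ζ < 1 / 2)
    (hphase : ∀ i, i ∉ F → (X.state 0 i).phase ∈ Set.Ico 0 (1 / 2))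
    (hfreq : ∀ i, i ∉ F → (X.state 0 i).freq ∈ Set.Icc 1 (1 + δ)) :
    X.IsRoundStart δ fun _ => 0 where
  flag i hi := (X.init i hi).1
  started i hi := (X.init i hi).2.1
  starts i hi := (X.init i hi).2.2.1
  ends i hi := (X.init i hi).2.2.2.1
  idle i hi _ := (X.init i hi).2.2.2.2
  phase_nonneg i hi := (hphase i hi).1
  phase_le i hi := by linarith [(hphase i hi).2]
  one_le_freq i hi := (hfreq i hi).1
  freq_le i hi := (hfreq i hi).2
  le_start _ _ _ _ := Nat.zero_le _
  silent _ _ _ _ _ _ h := absurd h (Nat.not_lt_zero _)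

/-- Frequencies are at least `1` and at most one turn is left, so the phases contribute at most the
initial arc and the frequencies at most their spread. -/
theorem fireTime_zero_sub_le
    (hphase : ∀ i, i ∉ F → (X.state 0 i).phase ∈ Set.Ico 0 (1 / 2))
    (hfreq : ∀ i, i ∉ F → (X.state 0 i).freq ∈ Set.Icc 1 (1 + X.initSpread)) {i j : V}
    (hi : i ∉ F) (hj : j ∉ F) :
    X.fireTime i 0 - X.fireTime j 0 ≤ X.initArc + X.initSpread := by
  have h1 := (hfreq i hi).1
  have h2 := (hfreq j hj).1
  have h3 : (X.state 0 j).freq - (X.state 0 i).freq ≤ X.initSpread :=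
    sub_le_spread (fun i => (X.state 0 i).freq) hj hi
  have h4 : (X.state 0 j).phase - (X.state 0 i).phase ≤ X.initArc :=
    sub_le_arcLength hphase hj hi
  have h5 : 0 ≤ X.initArc := by
    have : (X.state 0 j).phase - (X.state 0 j).phase ≤ X.initArc := sub_le_arcLength hphase hj hj
    rwa [sub_self] at this
  have h6 : 0 ≤ X.initSpread := spread_nonneg fun i => (X.state 0 i).freq
  obtain ⟨p1, p2⟩ := hphase i hi
  obtain ⟨q1, q2⟩ := hphase j hj
  rw [fireTime, fireTime]
  set p := (X.state 0 i).phase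
  set q := (X.state 0 j).phase
  set ω := (X.state 0 i).freq
  set ν := (X.state 0 j).freq
  have hω : 0 < ω := by linarith
  have hν : 0 < ν := by linarith
  have e : (1 - p) / ω - (1 - q) / ν = (q - p) / ω + (1 - q) * ((ν - ω) / (ω * ν)) := by
    field_simp; ring
  have e1 : (q - p) / ω ≤ X.initArc := by
    rw [div_le_iff₀ hω]; nlinarith
  have e2 : (ν - ω) / (ω * ν) ≤ X.initSpread := by
    rw [div_le_iff₀ (by positivity)]; nlinarith [mul_nonneg h6 (by nlinarith : 0 ≤ ω * ν - 1)]
  have e3 : (1 - q) * ((ν - ω) / (ω * ν)) ≤ X.initSpread := by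
    refine (mul_le_mul_of_nonneg_left e2 (by linarith)).trans ?_
    nlinarith
  linarith

end

/-! ### The sequence of rounds -/

/-- Node `i` starts its `r`-th round after event `X.roundStart r i`. -/
noncomputable def roundStart (X : Execution G F f ζ α) : ℕ → V → ℕ
  | 0 => fun _ => 0
  | r + 1 => fun i => X.nextUpdate i (X.roundStart r i) + 1

/-- The frequency of node `i` in its `r`-th round. -/
noncomputable def roundFreq (X : Execution G F f ζ α) (r : ℕ) (i : V) : ℝ :=
  (X.state (X.roundStart r i) i).freq

/-- The firing time of node `i` in its `r`-th round. -/
noncomputable def roundTime (X : Execution G F f ζ α) (r : ℕ) (i : V) : ℝ :=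
  X.fireTime i (X.roundStart r i)

/-- The `r`-th round takes place in good order. -/
structure IsGoodRound (X : Execution G F f ζ α) (r : ℕ) : Prop where
  start : X.IsRoundStart X.initSpread (X.roundStart r)
  small : spread F (X.roundTime r) + spread F (X.roundFreq r) + X.initSpread < 1 / 2 - ζ
  finish : ∀ i, i ∉ F → X.IsRoundEnd (X.roundStart r) i

section

variable {X : Execution G F f ζ α}

theorem initSpread_nonneg : 0 ≤ X.initSpread := spread_nonneg fun i => (X.state 0 i).freq

theorem fireTime_sub_le (r : ℕ) :
    ∀ i j, i ∉ F → j ∉ F → X.fireTime i (X.roundStart r i) - X.fireTime j (X.roundStart r j) ≤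
      spread F (X.roundTime r) := fun _ _ hi hj => sub_le_spread (X.roundTime r) hi hj

theorem IsGoodRound.time_small {r : ℕ} (h : X.IsGoodRound r) :
    spread F (X.roundTime r) + X.initSpread < 1 / 2 - ζ := by
  have := h.small
  have := spread_nonneg (F := F) (X.roundFreq r)
  linarith

theorem IsGoodRound.attracts_freq {r : ℕ} (h : X.IsGoodRound r) :
    Attracts G F f α (X.roundFreq r) (X.roundFreq (r + 1)) := fun i hi => (h.finish i hi).freq

theorem IsGoodRound.attracts_freq' {r : ℕ} (h : X.IsGoodRound r) :
    Attracts G F f α (-X.roundFreq r) (-X.roundFreq (r + 1)) := fun i hi => (h.finish i hi).freq'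

theorem spread_freq_contract (hlocal : IsLocalAttack G F f) (hrobust : IsRobust G (2 * f + 1))
    (hα : 0 < α) (hα' : α ≤ 1) {N : ℕ} (hN : numNormal F ≤ N + 1) {i₀ : V} (h₀ : i₀ ∉ F) {s : ℕ}
    (h : ∀ r, s ≤ r → r < s + N → X.IsGoodRound r) :
    spread F (X.roundFreq (s + N)) ≤ (1 - α ^ N / 2) * spread F (X.roundFreq s) := by
  obtain ⟨m, M, hmM, -, -, hle⟩ := exists_hull (X.roundFreq s) h₀
  refine spread_le h₀ fun i j hi hj => ?_
  have := hull_contract hlocal hrobust hα hα' hN (fun n => X.roundFreq (s + n))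
    (fun n => X.roundFreq (s + (n + 1))) (fun _ => 0) (fun _ => 0)
    (fun n hn => (h (s + n) (by omega) (by omega)).attracts_freq)
    (fun n hn => (h (s + n) (by omega) (by omega)).attracts_freq')
    (fun n hn i hi => by simp) (fun n hn i hi => by simp)
    (fun i hi => (hmM i hi).1) (fun i hi => (hmM i hi).2) hi hj
  simp only [Finset.sum_const_zero, add_zero] at this
  refine this.trans (mul_le_mul_of_nonneg_left hle ?_)
  have : α ^ N ≤ 1 := pow_le_one₀ hα.le hα'
  linarith

theorem IsGoodRound.spread_freq_succ {r : ℕ} (h : X.IsGoodRound r) {i₀ : V} (h₀ : i₀ ∉ F) :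
    spread F (X.roundFreq (r + 1)) ≤ spread F (X.roundFreq r) := by
  obtain ⟨m, M, hmM, -, -, hle⟩ := exists_hull (X.roundFreq r) h₀
  refine PulseSync.spread_le h₀ fun i j hi hj => ?_
  have h1 := h.attracts_freq.le hi fun i hi => (hmM i hi).2
  have h2 := h.attracts_freq'.ge hj fun i hi => (hmM i hi).1
  linarith

theorem IsGoodRound.time_bounds (hζ : 0 < ζ) (hζ' : ζ < 1 / 2) {r : ℕ} (h : X.IsGoodRound r)
    {i₀ : V} (h₀ : i₀ ∉ F) :
    ∃ c, ∀ j, j ∉ F → X.aimTime j (X.roundStart r j) + c ≤ X.roundTime (r + 1) j ∧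
      X.roundTime (r + 1) j ≤ X.aimTime j (X.roundStart r j) + c + spread F (X.roundFreq r) := by
  obtain ⟨m, M, hmM, ⟨a, ha, rfl⟩, -, hle⟩ := exists_hull (X.roundFreq r) h₀
  refine ⟨1 / M, fun j hj => ?_⟩
  have := h.start.fireTime_next_bounds hζ hζ' initSpread_nonneg (by linarith [h.time_small])
    (fireTime_sub_le r) hj (h.finish j hj) (h.start.one_le_freq a ha) hmM
  exact ⟨this.1, this.2.trans (add_le_add_right hle _)⟩

/-- The aims stay in the hull of the firing times and the common shift cancels; only the
perturbation can widen the spread. -/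
theorem IsGoodRound.spread_time_succ (hζ : 0 < ζ) (hζ' : ζ < 1 / 2) {r : ℕ} (h : X.IsGoodRound r)
    {i₀ : V} (h₀ : i₀ ∉ F) :
    spread F (X.roundTime (r + 1)) ≤ spread F (X.roundTime r) + spread F (X.roundFreq r) := by
  obtain ⟨c, hc⟩ := h.time_bounds hζ hζ' h₀
  obtain ⟨m, M, hmM, -, -, hle⟩ := exists_hull (X.roundTime r) h₀
  refine PulseSync.spread_le h₀ fun i j hi hj => ?_
  have h1 := (h.finish i hi).aim.le hi fun i hi => (hmM i hi).2
  have h2 := (h.finish j hj).aim'.ge hj fun i hi => (hmM i hi).1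
  linarith [hc i hi, hc j hj]

theorem spread_time_contract (hζ : 0 < ζ) (hζ' : ζ < 1 / 2) (hlocal : IsLocalAttack G F f)
    (hrobust : IsRobust G (2 * f + 1)) {N : ℕ} (hN : numNormal F ≤ N + 1) {i₀ : V} (h₀ : i₀ ∉ F)
    (h : ∀ r, X.IsGoodRound r) (s : ℕ) :
    spread F (X.roundTime (s + N)) ≤ (1 - (1 / 2) ^ N / 2) * spread F (X.roundTime s) +
      ∑ n ∈ Finset.range N, spread F (X.roundFreq (s + n)) := by
  obtain ⟨m, M, hmM, -, -, hle⟩ := exists_hull (X.roundTime s) h₀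
  choose c hc using fun r => (h r).time_bounds hζ hζ' h₀
  refine spread_le h₀ fun i j hi hj => ?_
  have := hull_contract hlocal hrobust (β := 1 / 2) (by norm_num) (by norm_num) hN
    (fun n => X.roundTime (s + n))
    (fun n i => X.aimTime i (X.roundStart (s + n) i)) (fun n => c (s + n))
    (fun n => spread F (X.roundFreq (s + n)))
    (fun n _ i hi => ((h (s + n)).finish i hi).aim)
    (fun n _ i hi => ((h (s + n)).finish i hi).aim')
    (fun n _ i hi => (hc (s + n) i hi).1) (fun n _ i hi => (hc (s + n) i hi).2)
    (fun i hi => (hmM i hi).1) (fun i hi => (hmM i hi).2) hi hj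
  refine this.trans (add_le_add_left (mul_le_mul_of_nonneg_left hle ?_) _)
  have : (1 / 2 : ℝ) ^ N ≤ 1 := pow_le_one₀ (by norm_num) (by norm_num)
  linarith

end

/-- Good earlier rounds bound the sum of the frequency spreads, hence the spread of the firing
times, and this makes the next round good. Of the `2` in `hinit`, one unit pays for turning initial
phases into firing times, the other is the slack `initSpread` in `IsGoodRound.small`. -/
theorem good_rounds (X : Execution G F f ζ α) (hζ : 0 < ζ) (hζ' : ζ < 1 / 2) (hα : 0 < α)
    (hα' : α ≤ 1) (hlocal : IsLocalAttack G F f) (hrobust : IsRobust G (2 * f + 1))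
    (hphase : ∀ i, i ∉ F → (X.state 0 i).phase ∈ Set.Ico 0 (1 / 2))
    (hfreq : ∀ i, i ∉ F → (X.state 0 i).freq ∈ Set.Icc 1 (1 + X.initSpread))
    {N : ℕ} (hN : numNormal F ≤ N + 1)
    (hinit : X.initArc + (2 + 2 * N / α ^ N) * X.initSpread < 1 / 2 - ζ)
    (hund : X.Undetected) {i₀ : V} (h₀ : i₀ ∉ F) (r : ℕ) : X.IsGoodRound r := by
  have hδ := X.initSpread_nonneg
  suffices key : ∀ r, (∀ s < r, X.IsGoodRound s) →
      X.IsRoundStart X.initSpread (X.roundStart r) ∧ spread F (X.roundTime r) ≤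
        X.initArc + X.initSpread + ∑ s ∈ Finset.range r, spread F (X.roundFreq s) by
    induction r using Nat.strong_induction_on with
    | _ r ih =>
      obtain ⟨hs, ht⟩ := key r ih
      have hanti : ∀ s ≤ r, spread F (X.roundFreq s) ≤ X.initSpread := by
        intro s hs
        induction s with
        | zero => exact le_rfl
        | succ s ihs => exact ((ih s (by omega)).spread_freq_succ h₀).trans (ihs (by omega))
      -- The sequence is cut off after `r`, since contraction is not yet known for windows reaching
      -- further.
      have hsum := sum_le_of_window_contract (N := N) (c := α ^ N)
        (δ := fun s => if s ≤ r then spread F (X.roundFreq s) else 0) (by positivity)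
        (fun s => by split_ifs; exacts [spread_nonneg _, le_rfl])
        (fun s => by
          rw [if_pos (Nat.zero_le r)]
          split_ifs with h
          · exact hanti s h
          · exact spread_nonneg _)
        (fun s => by
          have hq : 0 ≤ 1 - α ^ N / 2 := by
            have : α ^ N ≤ 1 := pow_le_one₀ hα.le hα'
            linarith
          split_ifs with h1 h2 h2
          · exact spread_freq_contract hlocal hrobust hα hα' hN h₀ fun t _ ht => ih t (by omega)
          · omega
          · exact mul_nonneg hq (spread_nonneg _)
          · simp) (r + 1)
      have hsum' : ∑ s ∈ Finset.range (r + 1), spread F (X.roundFreq s) ≤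
          2 * N / α ^ N * X.initSpread := by
        refine le_trans (le_of_eq (Finset.sum_congr rfl fun s hs => ?_)) hsum
        rw [if_pos (by have := Finset.mem_range.1 hs; omega)]
      rw [Finset.sum_range_succ] at hsum'
      have hsmall : spread F (X.roundTime r) + spread F (X.roundFreq r) + X.initSpread <
          1 / 2 - ζ := by linarith
      refine ⟨hs, hsmall, hs.all_end hζ hζ' hα hlocal hrobust hund hδ
        (D := spread F (X.roundTime r)) ?_ fun i j hi hj => sub_le_spread (X.roundTime r) hi hj⟩
      have := spread_nonneg (F := F) (X.roundFreq r)
      linarith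
  intro r
  induction r with
  | zero =>
    refine fun _ => ⟨isRoundStart_zero hζ' hphase hfreq, ?_⟩
    rw [Finset.sum_range_zero, add_zero]
    exact spread_le h₀ fun i j hi hj => fireTime_zero_sub_le hphase hfreq hi hj
  | succ r ih =>
    intro h
    obtain ⟨-, ht⟩ := ih fun s hs => h s (by omega)
    have hr := h r (by omega)
    refine ⟨hr.start.next hζ hζ' hδ hr.time_small (fireTime_sub_le r) hr.finish, ?_⟩
    rw [Finset.sum_range_succ]
    linarith [hr.spread_time_succ hζ hζ' h₀]

end Execution
end PulseSync

/-! ### From rounds to all times -/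

namespace PulseSync
namespace Execution

variable {V : Type*} [Fintype V] {G : Digraph V} {F : Finset V} {f : ℕ} {ζ α : ℝ}

theorem index_spec (X : Execution G F f ζ α) {t : ℝ} (ht : 0 ≤ t) :
    X.time (X.index t) ≤ t ∧ t < X.time (X.index t + 1) := by
  have hne : {k | X.time k ≤ t}.Nonempty := ⟨0, by simpa [X.time_zero] using ht⟩
  have hbdd : BddAbove {k | X.time k ≤ t} := by
    obtain ⟨n, hn⟩ := (X.time_tendsto.eventually_gt_atTop t).exists
    refine ⟨n, fun k hk => ?_⟩
    exact (X.lt_of_time_lt (lt_of_le_of_lt hk hn)).le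
  refine ⟨Nat.sSup_mem hne hbdd, ?_⟩
  by_contra! h
  have := le_csSup hbdd h
  simp only [index] at this
  omega

/-- The phase of node `i` at time `t`, lifted to the line, if `t` belongs to its `r`-th round. -/
noncomputable def lift (X : Execution G F f ζ α) (r : ℕ) (i : V) (t : ℝ) : ℝ :=
  r + X.roundFreq r i * (t - X.roundTime r i)

/-- Event `n` belongs to the `r`-th round of node `i`. -/
def InRound (X : Execution G F f ζ α) (r : ℕ) (i : V) (n : ℕ) : Prop :=
  X.roundStart r i ≤ n ∧ n < X.roundStart (r + 1) i

/-- A bound for the difference of lifted phases in the `r`-th round. -/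
noncomputable def phaseBound (X : Execution G F f ζ α) (r : ℕ) : ℝ :=
  (1 + X.initSpread) * spread F (X.roundTime r) +
    spread F (X.roundFreq r) * (1 + spread F (X.roundTime r))

section

variable {X : Execution G F f ζ α} (hζ : 0 < ζ) (hζ' : ζ < 1 / 2) (h : ∀ r, X.IsGoodRound r)

include hζ hζ' h

theorem roundStart_lt {i : V} (hi : i ∉ F) (r : ℕ) :
    X.roundStart r i < X.roundStart (r + 1) i := by
  have hr := (h r).start.isRound hζ hζ' hi
  have h1 := hr.le_start
  have h2 := hr.start_lt
  have h3 := hr.fire_lt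
  change _ < X.nextUpdate i (X.roundStart r i) + 1
  omega

theorem exists_inRound {i : V} (hi : i ∉ F) (n : ℕ) : ∃ r, X.InRound r i n := by
  have hmono : StrictMono fun r => X.roundStart r i :=
    strictMono_nat_of_lt_succ (roundStart_lt hζ hζ' h hi)
  have hex : ∃ r, n < X.roundStart (r + 1) i :=
    ⟨n, lt_of_lt_of_le (Nat.lt_succ_self n) (hmono.id_le (n + 1))⟩
  classical
  refine ⟨Nat.find hex, ?_, Nat.find_spec hex⟩
  rcases Nat.eq_zero_or_pos (Nat.find hex) with h0 | h0
  · rw [h0]; exact Nat.zero_le _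
  · obtain ⟨s, hs⟩ := Nat.exists_eq_succ_of_ne_zero h0.ne'
    have := Nat.find_min hex (m := s) (by omega)
    rw [hs]
    exact not_lt.1 this

/-- The rounds of any two normal nodes differ by at most one. -/
theorem inRound_le {i j : V} (hi : i ∉ F) (hj : j ∉ F) {r s n : ℕ} (hr : X.InRound r i n)
    (hs : X.InRound s j n) : s ≤ r + 1 := by
  by_contra! hlt
  have hmono : StrictMono fun r => X.roundStart r j :=
    strictMono_nat_of_lt_succ (roundStart_lt hζ hζ' h hj)
  have h1 : X.roundStart (r + 2) j ≤ X.roundStart s j := hmono.monotone (by omega)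
  -- Node `j` sends its start pulse of round `r + 1` only after `i` has entered that round.
  have h2 := (h (r + 1)).start.le_start i j hi hj
  have hj' := (h (r + 1)).start.isRound hζ hζ' hj
  have h3 := hj'.start_lt
  have h4 := hj'.fire_lt
  have h5 : X.roundStart (r + 2) j = X.nextUpdate j (X.roundStart (r + 1) j) + 1 := rfl
  have h6 := hr.2
  have h7 := hs.1
  omega

theorem freq_eq_roundFreq {i : V} (hi : i ∉ F) {r : ℕ} {t : ℝ}
    (hr : X.InRound r i (X.index t)) : X.freq i t = X.roundFreq r i :=
  ((h r).start.isRound hζ hζ' hi).freq_eq _ hr.1 (Nat.lt_succ_iff.1 hr.2)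

/-- The lift equals `r` at the firing of round `r`, where the phase passes from `1` to `0`; hence
the two offsets `1 - r` and `-r`. -/
theorem phase_eq_lift {i : V} (hi : i ∉ F) {r : ℕ} {t : ℝ}
    (hr : X.InRound r i (X.index t)) : ∃ z : ℤ, X.phase i t = X.lift r i t + z := by
  have hR := (h r).start.isRound hζ hζ' hi
  have hU := Nat.lt_succ_iff.1 hr.2
  have hf := hR.freq_eq _ hr.1 hU
  have e : X.phase i t = (X.state (X.index t) i).phase +
    (X.state (X.index t) i).freq * (t - X.time (X.index t)) := rfl
  rcases le_or_gt (X.index t) (X.nextFire i (X.roundStart r i)) with hF | hF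
  · refine ⟨1 - r, ?_⟩
    rw [e, hf, hR.phase_before_fire _ hr.1 hF, lift, roundFreq, roundTime]
    push_cast; ring
  · refine ⟨-r, ?_⟩
    rw [e, hf, hR.phase_after_fire _ hF hU, lift, roundFreq, roundTime]
    push_cast; ring

theorem time_sub_mem {i : V} (hi : i ∉ F) {r : ℕ} {t : ℝ} (ht : 0 ≤ t)
    (hr : X.InRound r i (X.index t)) :
    -1 ≤ t - X.roundTime r i ∧ t - X.roundTime r i ≤ 1 / 2 := by
  have hR := (h r).start.isRound hζ hζ' hi
  obtain ⟨t1, t2⟩ := X.index_spec ht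
  have h1 := X.time_mono hr.1
  have h2 : X.time (X.index t + 1) ≤ X.time (X.nextUpdate i (X.roundStart r i) + 1) :=
    X.time_mono hr.2
  rw [hR.time_update] at h2
  have hω := (h r).start.one_le_freq i hi
  have hp := (h r).start.phase_nonneg i hi
  have h3 : 1 / (2 * (X.state (X.roundStart r i) i).freq) ≤ 1 / 2 :=
    one_div_le_one_div_of_le (by norm_num) (by linarith)
  have h4 : (1 - (X.state (X.roundStart r i) i).phase) / (X.state (X.roundStart r i) i).freq ≤ 1 :=
    by rw [div_le_one (by linarith)]; linarith
  have h5 : X.roundTime r i = X.fireTime i (X.roundStart r i) := rfl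
  have h6 : X.fireTime i (X.roundStart r i) = X.time (X.roundStart r i) +
    (1 - (X.state (X.roundStart r i) i).phase) / (X.state (X.roundStart r i) i).freq := rfl
  constructor <;> linarith

theorem lift_sub_same {i j : V} (hi : i ∉ F) (hj : j ∉ F) {r : ℕ} {t : ℝ} (ht : 0 ≤ t)
    (hri : X.InRound r i (X.index t)) :
    |X.lift r i t - X.lift r j t| ≤ X.phaseBound r := by
  have e : X.lift r i t - X.lift r j t =
      (X.roundFreq r i - X.roundFreq r j) * (t - X.roundTime r i) +
      X.roundFreq r j * (X.roundTime r j - X.roundTime r i) := by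
    simp only [lift]; ring
  have h1 := abs_sub_le_spread (X.roundFreq r) hi hj
  have h2 := abs_sub_le_spread (X.roundTime r) hj hi
  obtain ⟨h3, h3'⟩ := time_sub_mem hζ hζ' h hi ht hri
  have h4 : |X.roundFreq r j| ≤ 1 + X.initSpread := by
    have h5 : 1 ≤ X.roundFreq r j := (h r).start.one_le_freq j hj
    rw [abs_of_nonneg (by linarith)]
    exact (h r).start.freq_le j hj
  have h0 := spread_nonneg (F := F) (X.roundFreq r)
  have h0' := spread_nonneg (F := F) (X.roundTime r)
  have h6 := X.initSpread_nonneg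
  rw [e, phaseBound]
  refine (abs_add_le _ _).trans ?_
  rw [abs_mul, abs_mul]
  have h7 : |t - X.roundTime r i| ≤ 1 := abs_le.2 ⟨h3, by linarith⟩
  have h8 := mul_le_mul h1 h7 (abs_nonneg _) h0
  have h9 := mul_le_mul h4 h2 (abs_nonneg _) (by linarith)
  nlinarith [mul_nonneg h0 h0']

theorem lift_sub_next {i j : V} (hi : i ∉ F) (hj : j ∉ F) {r : ℕ} {t : ℝ} (ht : 0 ≤ t)
    (hri : X.InRound r i (X.index t)) (hrj : X.InRound (r + 1) j (X.index t)) :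
    |X.lift (r + 1) j t - X.lift r i t| ≤ X.phaseBound r ∧
    |X.roundFreq (r + 1) j - X.roundFreq r i| ≤ spread F (X.roundFreq r) := by
  have hRi := (h r).start.isRound hζ hζ' hi
  have hRj := (h r).start.isRound hζ hζ' hj
  have hRj' := (h (r + 1)).start.isRound hζ hζ' hj
  have hend := (h r).finish j hj
  have hδ := X.initSpread_nonneg
  have hsmall := (h r).time_small
  obtain ⟨m, M, hmM, -, -, hle⟩ := exists_hull (X.roundFreq r) hi
  have g1 : m ≤ X.roundFreq (r + 1) j := (h r).attracts_freq'.ge hj fun i hi => (hmM i hi).1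
  have g2 : X.roundFreq (r + 1) j ≤ M := (h r).attracts_freq.le hj fun i hi => (hmM i hi).2
  have hdf : |X.roundFreq (r + 1) j - X.roundFreq r i| ≤ spread F (X.roundFreq r) := by
    have := hmM i hi
    exact abs_le.2 ⟨by linarith, by linarith⟩
  refine ⟨?_, hdf⟩
  have ha := hend.aim_sub_le hj (fireTime_sub_le r) hi
  have eT : X.time (X.roundStart (r + 1) j) =
      X.roundTime r j + 1 / (2 * X.roundFreq r j) := hRj.time_update
  have eF : X.roundTime (r + 1) j = X.time (X.roundStart (r + 1) j) +
      (1 - (X.state (X.roundStart (r + 1) j) j).phase) / X.roundFreq (r + 1) j := rfl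
  have eA : X.aimTime j (X.roundStart r j) = X.roundTime r j -
      ((X.state (X.roundStart (r + 1) j) j).phase - 1 / 2) / X.roundFreq r j := rfl
  have ω1 : 1 ≤ X.roundFreq r j := (h r).start.one_le_freq j hj
  have ω2 : 1 ≤ X.roundFreq (r + 1) j := (h (r + 1)).start.one_le_freq j hj
  have ν1 : 1 ≤ X.roundFreq r i := (h r).start.one_le_freq i hi
  have ω3 : X.roundFreq r j ≤ 1 + X.initSpread := (h r).start.freq_le j hj
  have ν3 : X.roundFreq r i ≤ 1 + X.initSpread := (h r).start.freq_le i hi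
  have hdt := abs_sub_le_spread (X.roundTime r) hj hi
  have hdw := abs_sub_le_spread (X.roundFreq r) hj hi
  obtain ⟨t1, t2⟩ := X.index_spec ht
  have u1 : X.time (X.roundStart (r + 1) j) ≤ t := (X.time_mono hrj.1).trans t1
  have u2 : t < X.roundTime r i + 1 / (2 * X.roundFreq r i) := by
    have : X.time (X.index t + 1) ≤ X.time (X.nextUpdate i (X.roundStart r i) + 1) :=
      X.time_mono hri.2
    rw [hRi.time_update] at this
    exact t2.trans_le this
  have hy : |X.aimTime j (X.roundStart r j) - X.roundTime r i| ≤ spread F (X.roundTime r) := ha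
  set p := (X.state (X.roundStart (r + 1) j) j).phase
  set u := X.time (X.roundStart (r + 1) j)
  set ω := X.roundFreq r j
  set ω' := X.roundFreq (r + 1) j
  set ν := X.roundFreq r i
  set a := X.roundTime r i
  set b := X.roundTime r j
  set y := X.aimTime j (X.roundStart r j)
  set d := spread F (X.roundFreq r)
  set D := spread F (X.roundTime r)
  set δ := X.initSpread
  have hω : ω ≠ 0 := by linarith
  have hω' : ω' ≠ 0 := by linarith
  have d0 : 0 ≤ d := spread_nonneg _
  have D0 : 0 ≤ D := spread_nonneg _
  -- Both lifts are followed from the update instant `u` of `j`. The first term is the distance of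
  -- the aim from the firing of `i`; the others are frequency differences times elapsed times.
  have e : X.lift (r + 1) j t - X.lift r i t =
      ω * (a - y) + (ω - ν) * (b - a) + (ω - ν) * (1 / (2 * ω)) + (ω' - ν) * (t - u) := by
    have l1 : X.lift (r + 1) j t = r + p + ω' * (t - u) := by
      have : X.lift (r + 1) j t = ((r + 1 : ℕ) : ℝ) + ω' * (t - X.roundTime (r + 1) j) := rfl
      rw [this, eF]
      push_cast
      field_simp
      ring
    have l2 : X.lift r i t = r + ν * (t - a) := rfl
    rw [l1, l2, eA, eT]
    field_simp
    ring
  have w1 : 1 / (2 * ω) ≤ 1 / 2 := one_div_le_one_div_of_le (by norm_num) (by linarith)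
  have w2 : 0 ≤ 1 / (2 * ω) := by positivity
  have w3 : 1 / (2 * ν) ≤ 1 / 2 := one_div_le_one_div_of_le (by norm_num) (by linarith)
  have w4 : (1 - δ) / 2 ≤ 1 / (2 * ω) := by
    rw [div_le_div_iff₀ (by norm_num) (by linarith)]
    nlinarith
  -- The instant `t` lies between the updates of `j` and `i`, which are at most `D + δ / 2` apart.
  have v1 : |t - u| ≤ 1 / 2 := by
    rw [abs_of_nonneg (by linarith)]
    have := (abs_le.1 hdt).1
    linarith
  have v2 : |1 / (2 * ω)| ≤ 1 / 2 := by rwa [abs_of_nonneg w2]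
  have v3 : |ω| ≤ 1 + δ := by rwa [abs_of_nonneg (by linarith)]
  rw [abs_sub_comm] at hy
  have m1 := mul_le_mul v3 hy (abs_nonneg _) (by linarith)
  have m2 := mul_le_mul hdw hdt (abs_nonneg _) d0
  have m3 := mul_le_mul hdw v2 (abs_nonneg _) d0
  have m4 := mul_le_mul hdf v1 (abs_nonneg _) d0
  rw [← abs_mul] at m1 m2 m3 m4
  have eB : X.phaseBound r = (1 + δ) * D + d * (1 + D) := rfl
  rw [e, eB]
  refine (abs_add_le _ _).trans ?_
  have n1 := abs_add_le (ω * (a - y) + (ω - ν) * (b - a)) ((ω - ν) * (1 / (2 * ω)))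
  have n2 := abs_add_le (ω * (a - y)) ((ω - ν) * (b - a))
  linarith

-- With `D`, `d` the spreads of firing times and frequencies and `δ` the initial frequency spread,
-- `d ≤ δ` and `D < 1 / 2` make the products at most `2 * δ * D ≤ δ`. The rest is
-- `IsGoodRound.small`.
omit hζ' in
theorem phaseBound_lt {i₀ : V} (h₀ : i₀ ∉ F) (r : ℕ) : X.phaseBound r < 1 / 2 := by
  have h1 := (h r).small
  have h2 := spread_nonneg (F := F) (X.roundFreq r)
  have h3 := spread_nonneg (F := F) (X.roundTime r)
  have h4 := X.initSpread_nonneg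
  have h5 : spread F (X.roundFreq r) ≤ X.initSpread := by
    induction r with
    | zero => exact le_rfl
    | succ r ih =>
      exact ((h r).spread_freq_succ h₀).trans
        (ih (h r).small (spread_nonneg _) (spread_nonneg _))
  rw [phaseBound]
  nlinarith

/-- Any two normal nodes are close to each other at all times. -/
theorem exists_round_pair {i j : V} (hi : i ∉ F) (hj : j ∉ F) {t : ℝ} (ht : 0 ≤ t) {r s : ℕ}
    (hr : X.InRound r i (X.index t)) (hs : X.InRound s j (X.index t)) :
    |X.lift r i t - X.lift s j t| ≤ X.phaseBound (min r s) ∧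
    |X.roundFreq r i - X.roundFreq s j| ≤ spread F (X.roundFreq (min r s)) := by
  have h1 := inRound_le hζ hζ' h hi hj hr hs
  have h2 := inRound_le hζ hζ' h hj hi hs hr
  rcases lt_trichotomy r s with hlt | rfl | hlt
  · obtain rfl : s = r + 1 := by omega
    rw [min_eq_left (by omega), abs_sub_comm, abs_sub_comm (X.roundFreq r i)]
    exact lift_sub_next hζ hζ' h hi hj ht hr hs
  · rw [min_self]
    exact ⟨lift_sub_same hζ hζ' h hi hj ht hr, abs_sub_le_spread _ hi hj⟩
  · obtain rfl : r = s + 1 := by omega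
    rw [min_eq_right (by omega)]
    exact lift_sub_next hζ hζ' h hj hi ht hs hr

theorem tendsto_spread_freq (hlocal : IsLocalAttack G F f) (hrobust : IsRobust G (2 * f + 1))
    (hα : 0 < α) (hα' : α ≤ 1) {i₀ : V} (h₀ : i₀ ∉ F) :
    Tendsto (fun r => spread F (X.roundFreq r)) atTop (𝓝 0) := by
  have h1 : α ^ numNormal F ≤ 1 := pow_le_one₀ hα.le hα'
  have h2 : 0 < α ^ numNormal F := by positivity
  refine tendsto_zero_of_window_contract (q := 1 - α ^ numNormal F / 2) (N := numNormal F)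
    (E := fun _ => 0) (B := 1) (by linarith) (by linarith) (fun r => spread_nonneg _)
    (fun r => ?_) tendsto_const_nhds fun r => ?_
  · have := (h r).small
    have := spread_nonneg (F := F) (X.roundTime r)
    linarith [X.initSpread_nonneg]
  · rw [add_zero]
    exact spread_freq_contract hlocal hrobust hα hα' (Nat.le_succ _) h₀ fun r _ _ => h r

theorem tendsto_spread_time (hlocal : IsLocalAttack G F f) (hrobust : IsRobust G (2 * f + 1))
    (hα : 0 < α) (hα' : α ≤ 1) {i₀ : V} (h₀ : i₀ ∉ F) :
    Tendsto (fun r => spread F (X.roundTime r)) atTop (𝓝 0) := by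
  have h1 : (1 / 2 : ℝ) ^ numNormal F ≤ 1 := pow_le_one₀ (by norm_num) (by norm_num)
  have h2 : 0 < (1 / 2 : ℝ) ^ numNormal F := by positivity
  refine tendsto_zero_of_window_contract (q := 1 - (1 / 2) ^ numNormal F / 2) (N := numNormal F)
    (E := fun r => ∑ n ∈ Finset.range (numNormal F), spread F (X.roundFreq (r + n))) (B := 1)
    (by linarith) (by linarith) (fun r => spread_nonneg _) (fun r => ?_) ?_ fun r => ?_
  · linarith [(h r).time_small, X.initSpread_nonneg]
  · have := tendsto_finsetSum (Finset.range (numNormal F)) fun n _ =>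
      (tendsto_spread_freq hζ hζ' h hlocal hrobust hα hα' h₀).comp (tendsto_add_atTop_nat n)
    simpa using this
  · exact spread_time_contract hζ hζ' hlocal hrobust (Nat.le_succ _) h₀ h r

theorem tendsto_phaseBound (hlocal : IsLocalAttack G F f) (hrobust : IsRobust G (2 * f + 1))
    (hα : 0 < α) (hα' : α ≤ 1) {i₀ : V} (h₀ : i₀ ∉ F) :
    Tendsto X.phaseBound atTop (𝓝 0) := by
  have h1 := tendsto_spread_freq hζ hζ' h hlocal hrobust hα hα' h₀
  have h2 := tendsto_spread_time hζ hζ' h hlocal hrobust hα hα' h₀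
  have := (h2.const_mul (1 + X.initSpread)).add (h1.mul (h2.const_add 1))
  rw [mul_zero, zero_mul, add_zero] at this
  exact this

/-- A quantity bounded in terms of the current rounds of two nodes tends to zero. -/
theorem tendsto_of_round_bound {i j : V} (hi : i ∉ F) (hj : j ∉ F) {g : ℝ → ℝ} {b : ℕ → ℝ}
    (hg : ∀ t, 0 ≤ g t) (hb : Tendsto b atTop (𝓝 0))
    (hgb : ∀ t, 0 ≤ t → ∀ r s, X.InRound r i (X.index t) → X.InRound s j (X.index t) →
      g t ≤ b (min r s)) : Tendsto g atTop (𝓝 0) := by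
  refine tendsto_order.2 ⟨fun a ha => Eventually.of_forall fun t => ha.trans_le (hg t),
    fun a ha => ?_⟩
  obtain ⟨r₀, hr₀⟩ := eventually_atTop.1 (hb.eventually_lt_const ha)
  have late : ∀ l, l ∉ F → ∀ t, 0 ≤ t → X.time (X.roundStart r₀ l) ≤ t →
      ∀ r, X.InRound r l (X.index t) → r₀ ≤ r := by
    intro l hl t ht hlt r hr
    by_contra! hcon
    have hmono : StrictMono fun r => X.roundStart r l :=
      strictMono_nat_of_lt_succ (roundStart_lt hζ hζ' h hl)
    have h1 : X.roundStart (r + 1) l ≤ X.roundStart r₀ l := hmono.monotone (by omega)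
    have h2 : X.index t + 1 ≤ X.roundStart r₀ l := le_trans hr.2 h1
    have h3 := X.time_mono h2
    linarith [(X.index_spec ht).2]
  filter_upwards [eventually_ge_atTop 0, eventually_ge_atTop (X.time (X.roundStart r₀ i)),
    eventually_ge_atTop (X.time (X.roundStart r₀ j))] with t ht hti htj
  obtain ⟨r, hr⟩ := exists_inRound hζ hζ' h hi (X.index t)
  obtain ⟨s, hs⟩ := exists_inRound hζ hζ' h hj (X.index t)
  exact (hgb t ht r s hr hs).trans_lt
    (hr₀ _ (le_min (late i hi t ht hti r hr) (late j hj t ht htj s hs)))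

theorem resilientSync (hlocal : IsLocalAttack G F f) (hrobust : IsRobust G (2 * f + 1))
    (hα : 0 < α) (hα' : α ≤ 1) : X.ResilientSync := by
  refine ⟨fun t ht => ⟨fun i hi => ?_, ?_⟩, fun i j hi hj => ⟨?_, ?_⟩⟩
  · obtain ⟨r, hr⟩ := exists_inRound hζ hζ' h hi (X.index t)
    rw [freq_eq_roundFreq hζ hζ' h hi hr]
    exact ⟨(h r).start.one_le_freq i hi, (h r).start.freq_le i hi⟩
  · choose! r hr using fun i (hi : i ∉ F) => exists_inRound hζ hζ' h hi (X.index t)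
    refine arcLength_lt (θ := fun i => X.lift (r i) i t) (by norm_num) (by norm_num)
      (fun i hi => phase_eq_lift hζ hζ' h hi (hr i hi)) fun i j hi hj => ?_
    exact (le_abs_self _).trans_lt ((exists_round_pair hζ hζ' h hi hj ht (hr i hi)
      (hr j hj)).1.trans_lt (phaseBound_lt hζ h hi _))
  · refine tendsto_of_round_bound hζ hζ' h hi hj (fun t => dist_nonneg)
      (tendsto_phaseBound hζ hζ' h hlocal hrobust hα hα' hi) fun t ht r s hr hs => ?_
    exact (dist_unitAddCircle_le (phase_eq_lift hζ hζ' h hi hr)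
      (phase_eq_lift hζ hζ' h hj hs)).trans (exists_round_pair hζ hζ' h hi hj ht hr hs).1
  · refine tendsto_of_round_bound hζ hζ' h hi hj (fun t => abs_nonneg _)
      (tendsto_spread_freq hζ hζ' h hlocal hrobust hα hα' hi) fun t ht r s hr hs => ?_
    rw [freq_eq_roundFreq hζ hζ' h hi hr, freq_eq_roundFreq hζ hζ' h hj hs]
    exact (exists_round_pair hζ hζ' h hi hj ht hr hs).2

end

/-! ### Degenerate cases and the comparison of constants -/

theorem resilientSync_of_forall_mem (X : Execution G F f ζ α) (h : ∀ i, i ∈ F) :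
    X.ResilientSync :=
  ⟨fun _ _ => ⟨fun i hi => absurd (h i) hi, arcLength_lt (θ := 0) (by norm_num) (by norm_num)
    (fun i hi => absurd (h i) hi) fun i _ hi => absurd (h i) hi⟩, fun i _ hi => absurd (h i) hi⟩

/-- For `K = 0` the empty window at the start, where nothing has been counted, would have to contain
an update. -/
theorem one_le_of_isUpdateBound {X : Execution G F f ζ α} {K : ℕ} (hK : X.IsUpdateBound K) {i : V}
    (hi : i ∉ F) : 1 ≤ K := by
  by_contra! h0
  obtain ⟨k, hk, -⟩ := hK 0 0 (by omega) (fun k hk j hj => by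
    rw [Nat.le_zero.1 hk, Osc.count, (X.init j hj).2.2.2.1]
    simp) i hi
  simp at hk

/-- Over the common denominator `α ^ (K * R)` the two numerators add up to `2 * R ≤ 2 * K * R`. -/
theorem growth_le {α : ℝ} (hα : 0 < α) (hα' : α ≤ 1) {K R : ℕ} (hK : 1 ≤ K) (hR : 1 ≤ R) :
    2 + 2 * ((R - 1 : ℕ) : ℝ) / α ^ (R - 1) ≤ 2 * K * R / α ^ (K * R) := by
  have hle : R ≤ K * R := Nat.le_mul_of_pos_left R hK
  have hp : 0 < α ^ (K * R) := by positivity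
  have h1 : 2 ≤ 2 / α ^ (K * R) := by
    rw [le_div_iff₀ hp]
    linarith [pow_le_one₀ hα.le hα' (n := K * R)]
  have h2 : 2 * ((R - 1 : ℕ) : ℝ) / α ^ (R - 1) ≤ 2 * ((R - 1 : ℕ) : ℝ) / α ^ (K * R) :=
    div_le_div_of_nonneg_left (by positivity) hp
      (pow_le_pow_of_le_one hα.le hα' ((Nat.sub_le R 1).trans hle))
  have h3 : 2 / α ^ (K * R) + 2 * ((R - 1 : ℕ) : ℝ) / α ^ (K * R) ≤
      2 * K * R / α ^ (K * R) := by
    rw [← add_div]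
    refine div_le_div_of_nonneg_right ?_ hp.le
    have : (R : ℝ) ≤ K * R := by exact_mod_cast hle
    rw [Nat.cast_sub hR]
    push_cast
    linarith
  linarith

end Execution
end PulseSync

theorem theorem3 {V : Type*} [Fintype V] (G : Digraph V) (F : Finset V) (f : ℕ) (ζ α : ℝ) (K : ℕ)
    (hζ : 0 < ζ) (hζ' : ζ < 1 / 2) (hα : 0 < α) (hα' : α ≤ 1)
    (hlocal : PulseSync.IsLocalAttack G F f)
    (hrobust : PulseSync.IsRobust G (2 * f + 1))
    (X : PulseSync.Execution G F f ζ α)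
    (hphase : ∀ i, i ∉ F → (X.state 0 i).phase ∈ Set.Ico 0 (1 / 2))
    (hfreq : ∀ i, i ∉ F → (X.state 0 i).freq ∈ Set.Icc 1 (1 + X.initSpread))
    (hK : X.IsUpdateBound K)
    (hinit : X.initArc +
      2 * K * PulseSync.numNormal F / α ^ (K * PulseSync.numNormal F) * X.initSpread < 1 / 2 - ζ) :
    X.ResilientSync ∨ ∃ k i, X.Detects k i ∧ ∃ j ∈ F, G.Adj i j := by
  by_cases hund : X.Undetected
  · left
    by_cases hne : ∃ i, i ∉ F
    · obtain ⟨i₀, h₀⟩ := hne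
      have hR : 1 ≤ PulseSync.numNormal F := Finset.card_pos.2 ⟨i₀, by simpa using h₀⟩
      refine PulseSync.Execution.resilientSync hζ hζ' ?_ hlocal hrobust hα hα'
      refine X.good_rounds hζ hζ' hα hα' hlocal hrobust hphase hfreq
        (N := PulseSync.numNormal F - 1) (by omega) (lt_of_le_of_lt ?_ hinit) hund h₀
      exact add_le_add_right (mul_le_mul_of_nonneg_right
        (PulseSync.Execution.growth_le hα hα'
          (PulseSync.Execution.one_le_of_isUpdateBound hK h₀) hR)
        X.initSpread_nonneg) _
    · push Not at hne
      exact X.resilientSync_of_forall_mem hne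
  · right
    rw [PulseSync.Execution.Undetected] at hund
    push Not at hund
    exact hund
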